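/- **Setting.** Let $T$ be a complete first-order theory with infinite models in a language $\mathcal L$, and let $\mathfrak C\models T$ be a monster model, i.e. $\mathfrak C$ is $\kappa$-saturated and strongly $\kappa$-homogeneous; "small" and "short" mean of size, resp. length, less than $\kappa$. Let $M\preceq\mathfrak C$ be a small elementary submodel, $\bar m$ an enumeration of $M$, and $\bar x,\bar y$ tuples of variables corresponding to $\bar m$. Let $\mathfrak C'\succeq\mathfrak C$ be a larger monster model in which $\mathfrak C$ is small. No NIP assumption is made. A (global) Keisler measure in $\bar y$ is a finitely additive probability measure $\mu$ on the $\mathfrak C$-definable subsets of $\mathfrak C^{\bar y}$; it is identified with the corresponding regular Borel probability measure on the type space $S_{\bar y}(\mathfrak C)$. Let $\mathfrak M_{\bar y}(\mathfrak C)$ be the set of all of them, and $\mathfrak M_{\bar m}(\mathfrak C)$ the set of those with $\mu(S_{\bar m}(\mathfrak C))=1$, where $S_{\bar m}(\mathfrak C)\subseteq S_{\bar y}(\mathfrak C)$ is the closed set of types extending $\mathrm{tp}(\bar m/\emptyset)$. The measure $\mu$ is $M$-invariant if $\mu(\varphi(\bar b;\bar y))=\mu(\varphi(\bar b';\bar y))$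 for every $\mathcal L$-formula $\varphi(\bar z;\bar y)$ and all short tuples $\bar b\equiv_M\bar b'$ from $\mathfrak C^{\bar z}$. Write $\mathfrak M^{\mathrm{inv}}_{\bar y}(\mathfrak C,M)$ and $\mathfrak M^{\mathrm{inv}}_{\bar m}(\mathfrak C,M)$ for the sets of $M$-invariant measures in $\mathfrak M_{\bar y}(\mathfrak C)$ and $\mathfrak M_{\bar m}(\mathfrak C)$. For $M$-invariant $\mu$ let $F_\mu^{\varphi}:S_{\bar z}(M)\to[0,1]$, $F_\mu^\varphi(q)=\mu(\varphi(\bar b;\bar y))$ for any $\bar b\models q$ in $\mathfrak C$; $\mu$ is Borel-definable (definable) over $M$ if all the maps $F_\mu^\varphi$ are Borel (continuous). For $\bar b\in\mathfrak C^{\bar x}$ let $h_{\bar b}:S_{\bar m}(\mathfrak C)\to S_{\bar x}(M)$, $\mathrm{tp}(\sigma(\bar m)/\mathfrak C)\mapsto\mathrm{tp}(\sigma^{-1}(\bar b)/M)$ for $\sigma\in\mathrm{Aut}(\mathfrak C')$. For $\mu\in\mathfrak M^{\mathrm{inv}}_{\bar y}(\mathfrak C,M)$ Borel-definable over $M$ and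 $\nu\in\mathfrak M_{\bar m}(\mathfrak C)$, the convolution product $\mu\ast\nu\in\mathfrak M_{\bar y}(\mathfrak C)$ is the Keisler measure given by $$(\mu\ast\nu)(\varphi(\bar b;\bar y))=\int_{S_{\bar x}(M)}F_\mu^{\varphi}\,d(h_{\bar b})_*(\nu)\qquad\text{for all }\mathcal L\text{-formulas }\varphi(\bar x;\bar y)\text{ and all }\bar b\in\mathfrak C^{\bar x}.$$ **Theorem.** Let $\nu,\lambda\in\mathfrak M^{\mathrm{inv}}_{\bar m}(\mathfrak C,M)$, where $\nu$ is Borel-definable over $M$, and let $\mu\in\mathfrak M^{\mathrm{inv}}_{\bar y}(\mathfrak C,M)$ be definable over $M$. Then $\mu\ast\nu$ is a well-defined Keisler measure that is $M$-invariant and Borel-definable over $M$, $\nu\ast\lambda$ is a well-defined Keisler measure in $\mathfrak M^{\mathrm{inv}}_{\bar m}(\mathfrak C,M)$, the products $(\mu\ast\nu)\ast\lambda$ and $\mu\ast(\nu\ast\lambda)$ are well-defined Keisler measures, and $$(\mu\ast\nu)\ast\lambda=\mu\ast(\nu\ast\lambda).$$ -/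

import Mathlib

open FirstOrder FirstOrder.Language MeasureTheory Cardinal

universe u v w w' x

noncomputable section

namespace KeislerConvolution

/-! ### Monster models -/

/-- `N` is `κ`-saturated: over every parameter set of size `< κ`, every finitely satisfiable set of
formulas in one variable is realized in `N`. -/
def IsSaturated (L : FirstOrder.Language.{u, v}) (N : Type w) [L.Structure N] (κ : Cardinal.{w}) : Prop :=
  ∀ A : Set N, #A < κ → ∀ Γ : Set (L.Formula (A ⊕ Unit)),
    (∀ Γ₀ : Finset (L.Formula (A ⊕ Unit)), (Γ₀ : Set (L.Formula (A ⊕ Unit))) ⊆ Γ →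
      ∃ a : N, ∀ φ ∈ Γ₀, φ.Realize (Sum.elim Subtype.val fun _ => a)) →
    ∃ a : N, ∀ φ ∈ Γ, φ.Realize (Sum.elim Subtype.val fun _ => a)

/-- `N` is strongly `κ`-homogeneous: every elementary map between subsets of size `< κ` extends to
an automorphism of `N`. -/
def IsStronglyHomogeneous (L : FirstOrder.Language.{u, v}) (N : Type w) [L.Structure N]
    (κ : Cardinal.{w}) : Prop :=
  ∀ A : Set N, #A < κ → ∀ f : A → N,
    (∀ φ : L.Formula A, φ.Realize Subtype.val ↔ φ.Realize f) →
    ∃ σ : N ≃[L] N, ∀ a : A, σ a = f a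

/-- `N` is a monster model (of its complete theory) with respect to the cardinal `κ`. -/
structure IsMonster (L : FirstOrder.Language.{u, v}) (N : Type w) [L.Structure N]
    (κ : Cardinal.{w}) : Prop where
  saturated : IsSaturated L N κ
  homogeneous : IsStronglyHomogeneous L N κ

/-! ### Type spaces -/

section Types

variable {L : FirstOrder.Language.{u, v}} {C : Type w} [L.Structure C] {A : Set C} {ι : Type x}

/-- The space `S_ι(A)` of complete types over `A ⊆ C` in variables indexed by `ι`, with Mathlib's
topology, whose basic clopen sets are given by formulas over `A`. -/
abbrev TypeSpace (L : FirstOrder.Language.{u, v}) (C : Type w) [L.Structure C] (A : Set C) (ι : Type x) :=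
  (L[[A]].completeTheory C).CompleteType ι

/-- Type spaces carry their Borel σ-algebra. -/
instance : MeasurableSpace (TypeSpace L C A ι) := borel _

instance : BorelSpace (TypeSpace L C A ι) := ⟨rfl⟩

/-- The formula `φ(ι)` with parameters from `A` belongs to the type `p`. -/
def Contains (p : TypeSpace L C A ι) (φ : L.Formula (A ⊕ ι)) : Prop :=
  Formula.equivSentence (BoundedFormula.constantsVarsEquiv.symm φ : L[[A]].Formula ι) ∈ p

/-- The tuple `a` of elements of `N` realizes `p`, that is `tp(a/A) = p`, where the parameters
from `A ⊆ C` are interpreted in `N` along the (elementary) map `e : C → N`. -/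
def Realizes {N : Type w'} [L.Structure N] (e : C → N) (a : ι → N) (p : TypeSpace L C A ι) : Prop :=
  ∀ φ : L.Formula (A ⊕ ι), Contains p φ ↔ φ.Realize (Sum.elim (fun c => e c) a)

/-- The closed subspace `S_m(C)` of the global types that extend `tp(m/∅)`. -/
def typesExtending (L : FirstOrder.Language.{u, v}) [L.Structure C] (m : ι → C) :
    Set (TypeSpace L C Set.univ ι) :=
  {p | ∀ φ : L.Formula ι, φ.Realize m → Contains p (φ.relabel Sum.inr)}

/-- `a ≡_A b`. -/
def SameType (L : FirstOrder.Language.{u, v}) [L.Structure C] (A : Set C) (a b : ι → C) : Prop :=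
  ∀ φ : L.Formula (A ⊕ ι),
    φ.Realize (Sum.elim Subtype.val a) ↔ φ.Realize (Sum.elim Subtype.val b)

end Types

/-! ### Keisler measures -/

section Measures

variable {L : FirstOrder.Language.{u, v}} {C : Type w} [L.Structure C] {A : Set C} {ι : Type x}

/-- The `A`-definable set of solutions of a formula with parameters from `A`. -/
def solutionSet (φ : L.Formula (A ⊕ ι)) : L.DefinableSet A ι :=
  ⟨{a | φ.Realize (Sum.elim Subtype.val a)}, Set.definable_iff_exists_formula_sum.2 ⟨φ, rfl⟩⟩

/-- The definable set `φ(b; C)`: here `b` is substituted for the first block of variables. -/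
def fiber {β : Type*} (φ : L.Formula (β ⊕ ι)) (b : β → C) : L.DefinableSet (Set.univ : Set C) ι :=
  solutionSet (φ.relabel (Sum.map (fun i => ⟨b i, Set.mem_univ (b i)⟩) id))

theorem mem_fiber {β : Type*} (φ : L.Formula (β ⊕ ι)) (b : β → C) (a : ι → C) :
    a ∈ fiber φ b ↔ φ.Realize (Sum.elim b a) := by
  change (φ.relabel _).Realize _ ↔ _
  rw [Formula.realize_relabel]
  refine iff_of_eq (congrArg φ.Realize ?_)
  funext i
  rcases i with i | i <;> rfl

/-- A Keisler measure over `A` in variables indexed by `ι`: a finitely additive probability measure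
on the `A`-definable subsets of `C ^ ι`. -/
structure KeislerMeasure (L : FirstOrder.Language.{u, v}) (C : Type w) [L.Structure C] (A : Set C)
    (ι : Type x) where
  toFun : L.DefinableSet A ι → ℝ
  nonneg : ∀ s, 0 ≤ toFun s
  top_eq_one : toFun ⊤ = 1
  additive : ∀ s t, Disjoint s t → toFun (s ⊔ t) = toFun s + toFun t

instance : CoeFun (KeislerMeasure L C A ι) fun _ => L.DefinableSet A ι → ℝ := ⟨fun μ => μ.toFun⟩

/-- Keisler measures in the variables `ι` over all of `C`. -/
abbrev GlobalMeasure (L : FirstOrder.Language.{u, v}) (C : Type w) [L.Structure C] (ι : Type x) :=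
  KeislerMeasure L C Set.univ ι

open Classical in
instance [Nonempty C] : Nonempty (KeislerMeasure L C A ι) := by
  let a : ι → C := fun _ => Classical.arbitrary C
  refine ⟨⟨fun s => if a ∈ s then 1 else 0, fun s => by split_ifs <;> norm_num,
    if_pos (DefinableSet.mem_top), fun s t h => ?_⟩⟩
  have h' : ¬ (a ∈ s ∧ a ∈ t) := fun hst => by
    have : a ∈ s ⊓ t := DefinableSet.mem_inf.2 hst
    rw [h.eq_bot] at this
    exact DefinableSet.notMem_bot this
  by_cases hs : a ∈ s <;> by_cases ht : a ∈ t <;> simp_all [DefinableSet.mem_sup]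

/-- `η` is a regular Borel measure on the type space that agrees with `μ` on formulas. -/
def IsBorelExtension (μ : KeislerMeasure L C A ι) (η : Measure (TypeSpace L C A ι)) : Prop :=
  η.Regular ∧ ∀ φ : L.Formula (A ⊕ ι), η {p | Contains p φ} = ENNReal.ofReal (μ (solutionSet φ))

/-- The (unique) regular Borel probability measure on the type space that corresponds to `μ`. -/
def borelMeasure (μ : KeislerMeasure L C A ι) : Measure (TypeSpace L C A ι) :=
  Classical.epsilon (IsBorelExtension μ)

/-- `μ ∈ 𝔐_m(C)`: the global measure `μ` concentrates on `tp(m/∅)`. -/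
def ConcentratesOn (m : ι → C) (μ : GlobalMeasure L C ι) : Prop :=
  borelMeasure μ (typesExtending L m) = 1

/-- `μ` is `M`-invariant: `μ(φ(b; y)) = μ(φ(b'; y))` whenever `b ≡_M b'` are short tuples. -/
def IsInvariantOver (κ : Cardinal.{w}) (M : L.ElementarySubstructure C)
    (μ : GlobalMeasure L C ι) : Prop :=
  ∀ β : Type w, #β < κ → ∀ (φ : L.Formula (β ⊕ ι)) (b b' : β → C),
    SameType L (M : Set C) b b' → μ (fiber φ b) = μ (fiber φ b')

/-- The map `F_{μ,M}^φ : S_β(M) → [0,1]`, sending `q` to `μ(φ(b; y))` for any `b ∈ C ^ β`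
realizing `q`. -/
def fiberMap [Nonempty C] {β : Type*} (M : L.ElementarySubstructure C) (μ : GlobalMeasure L C ι)
    (φ : L.Formula (β ⊕ ι)) (q : TypeSpace L C (M : Set C) β) : ℝ :=
  μ (fiber φ (Classical.epsilon fun b : β → C => Realizes id b q))

/-- `μ` is `M`-invariant and Borel-definable over `M`. -/
structure IsBorelDefinable [Nonempty C] (κ : Cardinal.{w}) (M : L.ElementarySubstructure C)
    (μ : GlobalMeasure L C ι) : Prop where
  invariant : IsInvariantOver κ M μ
  measurable : ∀ β : Type w, #β < κ → ∀ φ : L.Formula (β ⊕ ι), Measurable (fiberMap M μ φ)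

/-- `μ` is `M`-invariant and definable over `M`. -/
structure IsDefinable [Nonempty C] (κ : Cardinal.{w}) (M : L.ElementarySubstructure C)
    (μ : GlobalMeasure L C ι) : Prop where
  invariant : IsInvariantOver κ M μ
  continuous : ∀ β : Type w, #β < κ → ∀ φ : L.Formula (β ⊕ ι), Continuous (fiberMap M μ φ)

/-- The value `(μ ⊗ η)(φ(x; y)) = ∫_{S_x(M)} F_{μ,M}^φ dη` of the Morley product of the global
measure `μ` (in variables `y`) with a Borel measure `η` on `S_x(M)`. -/
def morleyProduct [Nonempty C] {β : Type*} (M : L.ElementarySubstructure C)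
    (μ : GlobalMeasure L C ι) (η : Measure (TypeSpace L C (M : Set C) β))
    (φ : L.Formula (β ⊕ ι)) : ℝ :=
  ∫ q, fiberMap M μ φ q ∂η

end Measures

/-! ### The convolution product -/

section Convolution

variable {L : FirstOrder.Language.{u, v}} {C : Type w} [L.Structure C] [Nonempty C]
  {C' : Type w'} [L.Structure C'] {M : L.ElementarySubstructure C} {ι : Type w}

/-- The tuple `m` of elements of `C` underlying an enumeration of `M`. -/
def tuple (m : ι ≃ M) : ι → C := fun i => (m i : C)

instance (A : Set C) : Nonempty (TypeSpace L C A ι) :=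
  ⟨Theory.typeOf _ fun _ => Classical.arbitrary C⟩

/-- The map `h_b : S_m(C) → S_x(M)`, `tp(σ(m)/C) ↦ tp(σ⁻¹(b)/M)` for `σ ∈ Aut(C')`, where `C'` is a
larger monster model, containing `C` via `j`. -/
def hMap (j : C ↪ₑ[L] C') (m : ι ≃ M) (b : ι → C) (p : typesExtending L (tuple m)) :
    TypeSpace L C (M : Set C) ι :=
  Classical.epsilon fun q => ∃ σ : C' ≃[L] C',
    Realizes j (fun i => σ (j (tuple m i))) p.1 ∧ Realizes j (fun i => σ.symm (j (b i))) q

/-- The measure `(h_b)_*(ν)` on `S_x(M)`, for `ν ∈ 𝔐_m(C)` viewed as a Borel measure on `S_m(C)`. -/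
def hPush (j : C ↪ₑ[L] C') (m : ι ≃ M) (b : ι → C) (ν : GlobalMeasure L C ι) :
    Measure (TypeSpace L C (M : Set C) ι) :=
  ((borelMeasure ν).comap (Subtype.val : typesExtending L (tuple m) → _)).map (hMap j m b)

/-- `ρ` is the convolution product of `μ` and `ν`: for all `b ∈ C ^ x` and all `L`-formulas
`φ(x; y)`, `ρ(φ(b; y)) = (μ_y ⊗ ((h_b)_* ν)_x)(φ(x; y))`. -/
def IsConvolution (j : C ↪ₑ[L] C') (m : ι ≃ M) (μ ν ρ : GlobalMeasure L C ι) : Prop :=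
  ∀ (b : ι → C) (φ : L.Formula (ι ⊕ ι)), ρ (fiber φ b) = morleyProduct M μ (hPush j m b ν) φ

/-- The convolution product `μ ∗ ν`, i.e. the Keisler measure given by the formula in
`IsConvolution`. -/
def starProduct (j : C ↪ₑ[L] C') (m : ι ≃ M) (μ ν : GlobalMeasure L C ι) : GlobalMeasure L C ι :=
  Classical.epsilon (IsConvolution j m μ ν)

end Convolution

end KeislerConvolution

end

open KeislerConvolution

namespace KeislerConvolution

/-! ### Measures on totally disconnected compact spaces -/

section Profinite

open TopologicalSpace
open scoped NNReal ENNReal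

variable {X : Type*} [TopologicalSpace X] [CompactSpace X] [T2Space X] [TotallyDisconnectedSpace X]

/-! Associativity comes from a uniform approximation of `μ`. Since `μ` is definable, `F_μ^φ` is
continuous on the profinite space `S_x(M)`, so within `1/n` it is an average of `n` indicators of
clopen sets, given by formulas `θ_k(x)` over `M` (`exists_clopens_average_near`). Write `θ_k(x) =
θ_k*(x; m)` with `θ_k*` over `∅`. By the definition of `h_b`, `((h_b)_* ν)(θ_k) = ν(θ_k*(b; y))`
(`conjugatePush_contains`). Hence `(μ ∗ ν)(φ(b; y))` is within `1/n` of the average of the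
`ν(θ_k*(b; y))`, with formulas `θ_k*` that depend neither on `ν` nor on `b`
(`exists_morleyProduct_near`).

This uniformity is used twice. As `b` varies, `F_{μ∗ν}^φ` is a uniform limit of averages of the maps
`F_ν^{θ_k*}`, so `μ ∗ ν` is Borel-definable. Integrating the same averages against `(h_b)_* λ`, `((μ
∗ ν) ∗ λ)(φ(b; y))` is within `1/n` of the average of the `(ν ∗ λ)(θ_k*(b; y))`. Putting `ν ∗ λ` in
place of `ν`, so is `(μ ∗ (ν ∗ λ))(φ(b; y))`. Let `n` tend to infinity.

That the products exist is a separate matter. Finitely additive measures extend uniquely to regular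
Borel measures. The map `h_b` is described without automorphisms: `h_b(p)` contains `φ` iff `p`
contains `φ*(b; y)`. It is therefore continuous, and it takes values in types of tuples `c` of `C`
with `c ≡ b` over `∅`. Relations between definable sets `φ(b; C)` and `ψ(b; C)` thus pass to `c`, so
the integral defining `μ ∗ ν` depends only on the set `φ(b; C)` and is additive in it. -/

theorem exists_clopens_between {K U : Set X} (hK : IsClosed K) (hU : IsOpen U) (h : K ⊆ U) :
    ∃ V : Clopens X, K ⊆ V ∧ (V : Set X) ⊆ U := by
  obtain ⟨V, hV, h1, h2⟩ := exists_clopen_of_closed_subset_open hK hU h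
  exact ⟨⟨V, hV⟩, h1, h2⟩

/-- The content on compact sets induced by a finitely additive function on clopen sets. -/
noncomputable def clopenContent (f : Clopens X → ℝ≥0)
    (hf : ∀ U V, Disjoint U V → f (U ⊔ V) = f U + f V) : Content X :=
  have hmono : ∀ {U V : Clopens X}, U ≤ V → f U ≤ f V := fun {U V} h => by
    rw [← sup_sdiff_cancel_right h, hf _ _ disjoint_sdiff_self_right]
    exact le_self_add
  have hsup : ∀ U V : Clopens X, f (U ⊔ V) ≤ f U + f V := fun U V => by
    rw [← sup_sdiff_self_right, hf _ _ disjoint_sdiff_self_right]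
    exact add_le_add le_rfl (hmono sdiff_le)
  have hle : ∀ (K : Compacts X) (U : Clopens X), (K : Set X) ⊆ U →
      ⨅ V : {V : Clopens X // (K : Set X) ⊆ V}, f V ≤ f U := fun K U h =>
    ciInf_le (OrderBot.bddBelow _) (⟨U, h⟩ : {V : Clopens X // (K : Set X) ⊆ V})
  have hne : ∀ K : Compacts X, Nonempty {V : Clopens X // (K : Set X) ⊆ V} := fun K =>
    ⟨⟨⊤, Set.subset_univ _⟩⟩
  have hadd : ∀ K₁ K₂ : Compacts X,
      ⨅ V : {V : Clopens X // ((K₁ ⊔ K₂ : Compacts X) : Set X) ⊆ V}, f V ≤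
      (⨅ V : {V : Clopens X // (K₁ : Set X) ⊆ V}, f V) +
        ⨅ V : {V : Clopens X // (K₂ : Set X) ⊆ V}, f V := fun K₁ K₂ => by
    have := hne K₁
    have := hne K₂
    refine NNReal.le_iInf_add_iInf fun U V => ?_
    refine (hle _ (U.1 ⊔ V.1) ?_).trans (hsup _ _)
    exact Set.union_subset_union U.2 V.2
  { toFun := fun K => ⨅ U : {U : Clopens X // (K : Set X) ⊆ U}, f U
    mono' := fun K₁ K₂ h => by
      have := hne K₂
      exact le_ciInf fun U => hle K₁ U.1 (h.trans U.2)
    sup_disjoint' := fun K₁ K₂ h h₁ h₂ => by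
      refine le_antisymm (hadd K₁ K₂) ?_
      have := hne (K₁ ⊔ K₂)
      refine le_ciInf fun W => ?_
      -- A clopen set `V` separating `K₁` from `K₂` cuts any clopen neighbourhood `W` of the union
      -- into neighbourhoods of the two pieces.
      obtain ⟨V, hV₁, hV₂⟩ :=
        exists_clopens_between h₁ h₂.isOpen_compl h.subset_compl_right
      have hW : f W.1 = f (W.1 ⊓ V) + f (W.1 \ V) := by
        rw [← hf _ _ disjoint_inf_sdiff, sup_inf_sdiff]
      rw [hW]
      have hWs : (K₁ : Set X) ∪ K₂ ⊆ W.1 := W.2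
      refine add_le_add (hle _ _ ?_) (hle _ _ ?_)
      · exact fun x hx => ⟨hWs (Or.inl hx), hV₁ hx⟩
      · exact fun x hx => ⟨hWs (Or.inr hx), fun hxV => hV₂ hxV hx⟩
    sup_le' := hadd }

theorem clopenContent_clopen (f : Clopens X → ℝ≥0)
    (hf : ∀ U V, Disjoint U V → f (U ⊔ V) = f U + f V) (U : Clopens X) :
    clopenContent f hf ⟨U, U.isClopen.isClosed.isCompact⟩ = f U := by
  refine congrArg _ (le_antisymm
    (ciInf_le (OrderBot.bddBelow _) (⟨U, subset_rfl⟩ : {V : Clopens X // (U : Set X) ⊆ V})) ?_)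
  have : Nonempty {V : Clopens X // (U : Set X) ⊆ V} := ⟨⟨⊤, Set.subset_univ _⟩⟩
  refine le_ciInf fun V => ?_
  have h : U ≤ V.1 := V.2
  rw [← sup_sdiff_cancel_right h, hf _ _ disjoint_sdiff_self_right]
  exact le_self_add

variable [MeasurableSpace X]

/-- A finitely additive function on the clopen subsets of a totally disconnected compact space
extends to a regular Borel measure. -/
theorem exists_regular_measure_of_clopens [BorelSpace X] (f : Clopens X → ℝ≥0)
    (hf : ∀ U V, Disjoint U V → f (U ⊔ V) = f U + f V) :
    ∃ η : Measure X, η.Regular ∧ ∀ U : Clopens X, η U = f U := by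
  refine ⟨(clopenContent f hf).measure, inferInstance, fun U => ?_⟩
  rw [Content.measure_apply _ U.isClopen.isOpen.measurableSet,
    Content.outerMeasure_of_isOpen _ _ U.isClopen.isOpen,
    Content.innerContent_of_isCompact _ U.isClopen.isClosed.isCompact]
  exact clopenContent_clopen f hf U

/-- A regular Borel measure is determined by its values on clopen sets. -/
theorem regular_measure_ext {η η' : Measure X} [η.Regular] [η'.Regular]
    (h : ∀ U : Clopens X, η U = η' U) : η = η' := by
  have key : ∀ {η η' : Measure X} [η.Regular], (∀ U : Clopens X, η U = η' U) →
      ∀ U : Set X, IsOpen U → η U ≤ η' U := by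
    intro η η' _ h U hU
    rw [hU.measure_eq_iSup_isCompact]
    refine iSup₂_le fun K hKU => iSup_le fun hK => ?_
    obtain ⟨V, hV₁, hV₂⟩ := exists_clopens_between hK.isClosed hU hKU
    exact (measure_mono hV₁).trans ((h V).trans_le (measure_mono hV₂))
  refine Measure.OuterRegular.ext_isOpen fun U hU => ?_
  exact le_antisymm (key h U hU) (key (fun U => (h U).symm) U hU)

end Profinite

/-- An intersection of clopen sets of full measure has full measure, for a regular measure. -/
theorem measure_iInter_clopens_compl_eq_zero {X : Type*} [TopologicalSpace X]
    [MeasurableSpace X] {η : Measure X} [η.Regular] {I : Type*}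
    (U : I → TopologicalSpace.Clopens X) (h : ∀ i, η (U i : Set X)ᶜ = 0) : η (⋂ i, (U i : Set X))ᶜ = 0 := by
  have ho : IsOpen (⋂ i, (U i : Set X))ᶜ :=
    (isClosed_iInter fun i => (U i).isClopen.isClosed).isOpen_compl
  -- The intersection may be uncountable. By inner regularity only compact subsets of its complement
  -- matter, and finitely many of the null complements cover each of them.
  rw [ho.measure_eq_iSup_isCompact]
  refine le_antisymm (iSup₂_le fun K hK => iSup_le fun hKc => ?_) zero_le
  rw [Set.compl_iInter] at hK
  obtain ⟨t, ht⟩ := hKc.elim_finite_subcover _ (fun i => (U i).isClopen.isClosed.isOpen_compl) hK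
  refine (measure_mono ht).trans ((measure_biUnion_finset_le t _).trans ?_)
  simp [h]

/-- A continuous function with values in `[0, 1]` on a totally disconnected compact space is
uniformly approximated by averages of indicators of clopen sets. -/
theorem exists_clopens_average_near {X : Type*} [TopologicalSpace X] [CompactSpace X] [T2Space X]
    [TotallyDisconnectedSpace X] {F : X → ℝ} (hF : Continuous F) (h0 : ∀ x, 0 ≤ F x)
    (h1 : ∀ x, F x ≤ 1) {n : ℕ} (hn : 0 < n) :
    ∃ U : Fin n → TopologicalSpace.Clopens X, ∀ x,
      |F x - ∑ k, (n : ℝ)⁻¹ * (U k : Set X).indicator (fun _ => 1) x| ≤ (n : ℝ)⁻¹ := by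
  have hn' : (0 : ℝ) < n := by exact_mod_cast hn
  -- Layer cake: `U k` lies between the closed set `F ≥ (k+1)/n` and the open set `F > k/n`.
  have : ∀ k : Fin n, ∃ V : TopologicalSpace.Clopens X,
      {x | ((k : ℕ) + 1 : ℝ) ≤ n * F x} ⊆ V ∧ (V : Set X) ⊆ {x | ((k : ℕ) : ℝ) < n * F x} := fun k =>
    exists_clopens_between (isClosed_le continuous_const (continuous_const.mul hF))
      (isOpen_lt continuous_const (continuous_const.mul hF))
      (fun x hx => by
        simp only [Set.mem_ofPred_eq] at hx ⊢
        linarith)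
  choose U hU₁ hU₂ using this
  refine ⟨U, fun x => ?_⟩
  classical
  set s : Finset (Fin n) := {k | x ∈ (U k : Set X)} with hs
  have hsum : ∑ k, (n : ℝ)⁻¹ * (U k : Set X).indicator (fun _ => 1) x = (n : ℝ)⁻¹ * s.card := by
    rw [← Finset.mul_sum, hs, Finset.card_filter]
    push_cast
    congr 1
  have hnF0 : 0 ≤ n * F x := mul_nonneg hn'.le (h0 x)
  have hnF1 : n * F x ≤ n := mul_le_of_le_one_right hn'.le (h1 x)
  -- the number of layers containing `x` is within `1` of `n * F x`
  have hlow : n * F x - 1 ≤ s.card := by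
    have hsub : (Finset.univ.filter fun k : Fin n => (k : ℕ) < ⌊n * F x⌋₊) ⊆ s := fun k hk => by
      simp only [Finset.mem_filter, Finset.mem_univ, true_and] at hk
      refine Finset.mem_filter.2 ⟨Finset.mem_univ _, hU₁ k ?_⟩
      have := (Nat.le_floor_iff hnF0).1 (Nat.succ_le_of_lt hk)
      simpa using this
    have hc := Finset.card_le_card hsub
    have hfl : ⌊n * F x⌋₊ ≤ n := Nat.floor_le_of_le hnF1
    rw [Fin.card_filter_val_lt, min_eq_right hfl] at hc
    have := Nat.sub_one_lt_floor (n * F x)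
    have hc' : (⌊n * F x⌋₊ : ℝ) ≤ s.card := by exact_mod_cast hc
    linarith
  have hhigh : (s.card : ℝ) ≤ n * F x + 1 := by
    have hsub : s ⊆ Finset.univ.filter fun k : Fin n => (k : ℕ) < ⌈n * F x⌉₊ := fun k hk => by
      have := hU₂ k (Finset.mem_filter.1 hk).2
      exact Finset.mem_filter.2 ⟨Finset.mem_univ _, Nat.lt_ceil.2 this⟩
    have hc := Finset.card_le_card hsub
    have hfl : ⌈n * F x⌉₊ ≤ n := Nat.ceil_le.2 hnF1
    rw [Fin.card_filter_val_lt, min_eq_right hfl] at hc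
    have := Nat.ceil_lt_add_one hnF0
    have hc' : (s.card : ℝ) ≤ ⌈n * F x⌉₊ := by exact_mod_cast hc
    linarith
  rw [hsum]
  have : F x - (n : ℝ)⁻¹ * s.card = (n : ℝ)⁻¹ * (n * F x - s.card) := by
    field_simp
  rw [this, abs_mul, abs_of_pos (inv_pos.2 hn')]
  refine mul_le_of_le_one_right (inv_pos.2 hn').le (abs_le.2 ⟨by linarith, by linarith⟩)

/-! ### Formulas and complete types -/

section Quantifier

variable {L : FirstOrder.Language.{u, v}} {α β : Type*}

open Classical in
instance finite_inr_freeVars (ψ : L.Formula (α ⊕ β)) :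
    Finite {i : β // Sum.inr i ∈ ψ.freeVarFinset} :=
  Finite.of_injective (fun i => (⟨Sum.inr i.1, i.2⟩ : ψ.freeVarFinset)) fun i j h => by
    simpa [Subtype.ext_iff] using h

open Classical in
/-- Existential quantification over all the variables indexed by `β`, of which only finitely many
occur. -/
noncomputable def exOver (ψ : L.Formula (α ⊕ β)) : L.Formula α :=
  Formula.iExs {i : β // Sum.inr i ∈ ψ.freeVarFinset}
    (ψ.restrictFreeVar (fun z : ψ.freeVarFinset =>
      (match z with
      | ⟨Sum.inl i, _⟩ => Sum.inl i
      | ⟨Sum.inr i, h⟩ => Sum.inr ⟨i, h⟩ :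
        α ⊕ {i : β // Sum.inr i ∈ ψ.freeVarFinset})) :
      L.Formula (α ⊕ {i : β // Sum.inr i ∈ ψ.freeVarFinset}))

theorem realize_exOver {N : Type*} [L.Structure N] [Nonempty N] (ψ : L.Formula (α ⊕ β))
    (v : α → N) : (exOver ψ).Realize v ↔ ∃ e : β → N, ψ.Realize (Sum.elim v e) := by
  classical
  rw [exOver, Formula.realize_iExs]
  constructor
  · rintro ⟨e, he⟩
    -- Variables that do not occur in `ψ` receive an arbitrary value.
    refine ⟨fun i => if h : Sum.inr i ∈ ψ.freeVarFinset then e ⟨i, h⟩ else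
      Classical.arbitrary N, ?_⟩
    refine (BoundedFormula.realize_restrictFreeVar _ ?_).1 he
    rintro ⟨i | i, h⟩
    · rfl
    · simp [h]
  · rintro ⟨e, he⟩
    refine ⟨fun i => e i, ?_⟩
    refine (BoundedFormula.realize_restrictFreeVar _ ?_).2 he
    rintro ⟨i | i, h⟩ <;> rfl

end Quantifier

/-! ### Complete types over parameters and their clopen sets. -/

section Types

variable {L : FirstOrder.Language.{u, v}} {C : Type w} [L.Structure C] {A : Set C} {ι : Type x}

/-- Every complete type is realized in some structure in which the parameters have the same type
as in `C`. -/
theorem exists_realization (p : TypeSpace L C A ι) :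
    ∃ (N : Type (max u v w x)) (_ : L.Structure N) (_ : Nonempty N) (e : A → N) (a : ι → N),
      (∀ φ : L.Formula A, φ.Realize (Subtype.val : A → C) ↔ φ.Realize e) ∧
      ∀ φ : L.Formula (A ⊕ ι), Contains p φ ↔ φ.Realize (Sum.elim e a) := by
  obtain ⟨N, a, rfl⟩ := Theory.exists_modelType_is_realized_in _ p
  let _ : L.Structure N := (L.lhomWithConstants A).reduct N
  refine ⟨N, inferInstance, inferInstance, fun c => (L.con c : N), a, fun φ => ?_, fun φ => ?_⟩
  · have h := Formula.realize_equivSentence C φ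
    have h' := Formula.realize_equivSentence N φ
    have : N ⊨ Formula.equivSentence φ ↔ C ⊨ Formula.equivSentence φ :=
      realize_iff_of_model_completeTheory C N _
    exact h.symm.trans (this.symm.trans h')
  · rw [Contains, Theory.CompleteType.formula_mem_typeOf]
    have := BoundedFormula.realize_constantsVarsEquiv (L := L) (M := N) (α := A)
      (φ := (BoundedFormula.constantsVarsEquiv.symm φ : L[[A]].Formula ι)) (v := a)
      (xs := default)
    rw [Equiv.apply_symm_apply] at this
    exact this.symm

theorem contains_inf (p : TypeSpace L C A ι) (φ ψ : L.Formula (A ⊕ ι)) :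
    Contains p (φ ⊓ ψ) ↔ Contains p φ ∧ Contains p ψ := by
  obtain ⟨N, _, _, e, a, -, h⟩ := exists_realization p
  simp only [h, Formula.realize_inf]

theorem contains_sup (p : TypeSpace L C A ι) (φ ψ : L.Formula (A ⊕ ι)) :
    Contains p (φ ⊔ ψ) ↔ Contains p φ ∨ Contains p ψ := by
  obtain ⟨N, _, _, e, a, -, h⟩ := exists_realization p
  simp only [h, Formula.realize_sup]

theorem contains_not (p : TypeSpace L C A ι) (φ : L.Formula (A ⊕ ι)) :
    Contains p φ.not ↔ ¬ Contains p φ := by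
  obtain ⟨N, _, _, e, a, -, h⟩ := exists_realization p
  simp only [h, Formula.realize_not]

/-- A formula contained in a type is satisfiable. -/
theorem exists_realize_of_contains [Nonempty C] {p : TypeSpace L C A ι} {φ : L.Formula (A ⊕ ι)}
    (h : Contains p φ) : ∃ a : ι → C, φ.Realize (Sum.elim Subtype.val a) := by
  obtain ⟨N, _, _, e, a, he, hN⟩ := exists_realization p
  exact (realize_exOver _ _).1 ((he _).2 ((realize_exOver _ _).2 ⟨a, (hN φ).1 h⟩))

theorem contains_mono [Nonempty C] {p : TypeSpace L C A ι} {φ ψ : L.Formula (A ⊕ ι)}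
    (h : ∀ a : ι → C, φ.Realize (Sum.elim Subtype.val a) → ψ.Realize (Sum.elim Subtype.val a))
    (hφ : Contains p φ) : Contains p ψ := by
  by_contra hψ
  obtain ⟨a, ha⟩ := exists_realize_of_contains
    ((contains_inf p _ _).2 ⟨hφ, (contains_not p ψ).2 hψ⟩)
  rw [Formula.realize_inf, Formula.realize_not] at ha
  exact ha.2 (h a ha.1)

theorem contains_congr [Nonempty C] {p : TypeSpace L C A ι} {φ ψ : L.Formula (A ⊕ ι)}
    (h : ∀ a : ι → C, φ.Realize (Sum.elim Subtype.val a) ↔ ψ.Realize (Sum.elim Subtype.val a)) :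
    Contains p φ ↔ Contains p ψ :=
  ⟨contains_mono fun a => (h a).1, contains_mono fun a => (h a).2⟩

theorem contains_of_forall [Nonempty C] {p : TypeSpace L C A ι} {φ : L.Formula (A ⊕ ι)}
    (h : ∀ a : ι → C, φ.Realize (Sum.elim Subtype.val a)) : Contains p φ := by
  by_contra hφ
  obtain ⟨a, ha⟩ := exists_realize_of_contains ((contains_not p φ).2 hφ)
  exact ha (h a)

/-- The formulas over `A` are the sentences which make up types. -/
theorem exists_contains_iff_mem (φ : L[[A]][[ι]].Sentence) :
    ∃ ψ : L.Formula (A ⊕ ι), ∀ p : TypeSpace L C A ι, Contains p ψ ↔ φ ∈ p := by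
  refine ⟨BoundedFormula.constantsVarsEquiv (Formula.equivSentence.symm φ), fun p => ?_⟩
  rw [Contains, Equiv.symm_apply_apply, Equiv.apply_symm_apply]

theorem typeSpace_ext {p q : TypeSpace L C A ι}
    (h : ∀ φ : L.Formula (A ⊕ ι), Contains p φ ↔ Contains q φ) : p = q := by
  refine SetLike.ext fun φ => ?_
  obtain ⟨ψ, hψ⟩ := exists_contains_iff_mem (A := A) (C := C) φ
  rw [← hψ, ← hψ, h]

theorem isClopen_contains (φ : L.Formula (A ⊕ ι)) :
    IsClopen {p : TypeSpace L C A ι | Contains p φ} :=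
  CompleteType.isClopen_typesWith _

/-- The clopen set of types containing a formula. -/
def clopenOf (φ : L.Formula (A ⊕ ι)) : TopologicalSpace.Clopens (TypeSpace L C A ι) :=
  ⟨{p | Contains p φ}, isClopen_contains φ⟩

theorem isTopologicalBasis_contains : TopologicalSpace.IsTopologicalBasis
    (Set.range fun φ : L.Formula (A ⊕ ι) => {p : TypeSpace L C A ι | Contains p φ}) := by
  convert CompleteType.isTopologicalBasis_range_typesWith
    (T := L[[A]].completeTheory C) (α := ι) using 1
  ext s
  constructor
  · rintro ⟨φ, rfl⟩
    exact ⟨_, rfl⟩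
  · rintro ⟨φ, rfl⟩
    obtain ⟨ψ, hψ⟩ := exists_contains_iff_mem (A := A) (C := C) φ
    exact ⟨ψ, Set.ext fun p => hψ p⟩

/-- Compactness: a clopen set is a finite union of basic ones, and disjunction turns this union into
a single formula. -/
theorem exists_clopenOf_eq (U : TopologicalSpace.Clopens (TypeSpace L C A ι)) :
    ∃ φ : L.Formula (A ⊕ ι), clopenOf φ = U := by
  have : ∃ φ : L.Formula (A ⊕ ι), {p : TypeSpace L C A ι | Contains p φ} = U := by
    have hb := isTopologicalBasis_contains (L := L) (C := C) (A := A) (ι := ι)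
    refine U.isClopen.isClosed.isCompact.induction_on
      (p := fun s => ∃ φ : L.Formula (A ⊕ ι), s ⊆ {p | Contains p φ} ∧
        {p : TypeSpace L C A ι | Contains p φ} ⊆ U) ⟨⊥, ?_⟩ ?_ ?_ ?_ |>.imp
        fun φ h => h.2.antisymm h.1
    · refine ⟨Set.empty_subset _, fun p hp => ?_⟩
      obtain ⟨N, _, _, e, a, -, h⟩ := exists_realization p
      exact ((h _).1 hp).elim
    · rintro s t hst ⟨φ, h1, h2⟩
      exact ⟨φ, hst.trans h1, h2⟩
    · rintro s t ⟨φ, h1, h2⟩ ⟨ψ, h3, h4⟩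
      refine ⟨φ ⊔ ψ, ?_, fun p hp => ?_⟩
      · rintro p (hp | hp)
        · exact (contains_sup p φ ψ).2 (Or.inl (h1 hp))
        · exact (contains_sup p φ ψ).2 (Or.inr (h3 hp))
      · exact ((contains_sup p φ ψ).1 hp).elim (fun h => h2 h) fun h => h4 h
    · intro p hp
      obtain ⟨_, ⟨φ, rfl⟩, h1, h2⟩ := hb.exists_subset_of_mem_open hp U.isClopen.isOpen
      exact ⟨_, mem_nhdsWithin_of_mem_nhds ((isClopen_contains φ).isOpen.mem_nhds h1),
        φ, subset_rfl, h2⟩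
  obtain ⟨φ, h⟩ := this
  exact ⟨φ, TopologicalSpace.Clopens.ext h⟩

/-- The type over `A` of a tuple of `C`. -/
noncomputable def tpOver [Nonempty C] (A : Set C) (a : ι → C) : TypeSpace L C A ι :=
  Theory.typeOf _ a

theorem contains_tpOver [Nonempty C] (a : ι → C) (φ : L.Formula (A ⊕ ι)) :
    Contains (tpOver A a) φ ↔ φ.Realize (Sum.elim Subtype.val a) := by
  rw [Contains, tpOver, Theory.CompleteType.formula_mem_typeOf]
  have := BoundedFormula.realize_constantsVarsEquiv (L := L) (M := C) (α := A)
    (φ := (BoundedFormula.constantsVarsEquiv.symm φ : L[[A]].Formula ι)) (v := a)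
    (xs := default)
  rw [Equiv.apply_symm_apply] at this
  exact this.symm

theorem realizes_tpOver [Nonempty C] (a : ι → C) :
    Realizes (L := L) id a (tpOver A a) := fun φ => contains_tpOver a φ

end Types

/-! ### Realizing types of small tuples in saturated models -/

section Saturation

variable {L : FirstOrder.Language.{u, v}} {N : Type w} [L.Structure N] {α : Type*} {β : Type x}

/-- The truth value in `N` of the formula `φ`, with the variables in `α` interpreted by `e`, depends
only on the values of the variables in `s`. -/
def DependsOnlyOn (e : α → N) (s : Set β) (φ : L.Formula (α ⊕ β)) : Prop :=
  ∀ b b' : β → N, (∀ i ∈ s, b i = b' i) →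
    (φ.Realize (Sum.elim e b) ↔ φ.Realize (Sum.elim e b'))

theorem exists_finset_dependsOnlyOn (e : α → N) (φ : L.Formula (α ⊕ β)) :
    ∃ s : Finset β, DependsOnlyOn e s φ := by
  classical
  refine ⟨φ.freeVarFinset.toRight, fun b b' h => ?_⟩
  have h' := BoundedFormula.realize_restrictFreeVar (φ := φ) (f := id)
    (v := fun z => Sum.elim e b z.1) (xs := default) (Sum.elim e b) fun z => rfl
  refine h'.symm.trans (BoundedFormula.realize_restrictFreeVar (φ := φ) (f := id)
    (v := fun z => Sum.elim e b z.1) (xs := default) (Sum.elim e b') ?_)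
  rintro ⟨i | i, hi⟩
  · rfl
  · exact h i (by simpa using hi)

/-- Pass from `b` to `b'` through the tuple that agrees with `b` on `s` and with `b'` off `s`. -/
theorem DependsOnlyOn.inter {e : α → N} {s t : Set β} {φ : L.Formula (α ⊕ β)}
    (hs : DependsOnlyOn e s φ) (ht : DependsOnlyOn e t φ) : DependsOnlyOn e (s ∩ t) φ := by
  classical
  intro b b' h
  refine (hs b (fun i => if i ∈ s then b i else b' i) fun i hi => by simp [hi]).trans
    (ht _ b' fun i hi => ?_)
  by_cases his : i ∈ s
  · simpa [his] using h i ⟨his, hi⟩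
  · simp [his]

theorem DependsOnlyOn.mono {e : α → N} {s t : Set β} {φ : L.Formula (α ⊕ β)}
    (hs : DependsOnlyOn e s φ) (h : s ⊆ t) : DependsOnlyOn e t φ :=
  fun b b' hb => hs b b' fun i hi => hb i (h hi)

open Classical in
/-- Existential quantification over the variable `i`. -/
noncomputable def exAt (i : β) (φ : L.Formula (α ⊕ β)) : L.Formula (α ⊕ β) :=
  exOver (φ.relabel (Sum.elim (fun a => Sum.inl (Sum.inl a))
    (fun j => if j = i then Sum.inr () else Sum.inl (Sum.inr j))) : L.Formula ((α ⊕ β) ⊕ Unit))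

theorem realize_exAt [Nonempty N] [DecidableEq β] (i : β) (φ : L.Formula (α ⊕ β)) (e : α → N) (b : β → N) :
    (exAt i φ).Realize (Sum.elim e b) ↔ ∃ c : N, φ.Realize (Sum.elim e (Function.update b i c)) := by
  rw [exAt, realize_exOver]
  have key : ∀ f : Unit → N, Sum.elim (Sum.elim e b) f ∘ (Sum.elim (fun a => Sum.inl (Sum.inl a))
    (fun j => @ite _ (j = i) (Classical.propDecidable _) (Sum.inr ()) (Sum.inl (Sum.inr j)))) =
      Sum.elim e (Function.update b i (f ())) := by
    intro f
    funext j
    rcases j with j | j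
    · rfl
    · by_cases h : j = i
      · subst h; simp
      · simp [h]
  constructor
  · rintro ⟨f, hf⟩
    rw [Formula.realize_relabel, key] at hf
    exact ⟨_, hf⟩
  · rintro ⟨c, hc⟩
    refine ⟨fun _ => c, ?_⟩
    rwa [Formula.realize_relabel, key]

/-- In a `κ`-saturated structure, a complete consistent set of formulas in fewer than `κ` variables
over fewer than `κ` parameters is realized. -/
theorem IsSaturated.exists_realize [Nonempty N] {κ : Cardinal.{w}} (hN : IsSaturated L N κ)
    (hκ : ℵ₀ ≤ κ) (e : α → N) (he : #(Set.range e) < κ)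
    (hβ : Cardinal.lift.{w} #β < Cardinal.lift.{x} κ) (Φ : Set (L.Formula (α ⊕ β)))
    (hcompl : ∀ φ, φ ∈ Φ ∨ φ.not ∈ Φ) (hinf : ∀ φ ∈ Φ, ∀ ψ ∈ Φ, φ ⊓ ψ ∈ Φ)
    (hsat : ∀ φ ∈ Φ, ∃ b : β → N, φ.Realize (Sum.elim e b)) :
    ∃ b : β → N, ∀ φ ∈ Φ, φ.Realize (Sum.elim e b) := by
  classical
  obtain ⟨_, _⟩ := exists_wellFoundedLT β
  -- Transfinite recursion along a well-order of `β`: `b i` is chosen so that, together with the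
  -- earlier values, it satisfies every formula of `Φ` in the variables up to `i`. That such a
  -- choice exists is shown inside the induction `key`.
  let F : ∀ i : β, (∀ j, j < i → N) → N := fun i ih => Classical.epsilon fun c =>
    ∀ φ ∈ Φ, DependsOnlyOn e (Set.Iic i) φ →
      φ.Realize (Sum.elim e fun j => if h : j < i then ih j h else c)
  let b : β → N := wellFounded_lt.fix F
  have hb : ∀ i, b i = F i fun j _ => b j := fun i => wellFounded_lt.fix_eq F i
  have key : ∀ i, ∀ φ ∈ Φ, DependsOnlyOn e (Set.Iic i) φ → φ.Realize (Sum.elim e b) := by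
    intro i
    induction i using WellFoundedLT.induction with
    | ind i IH =>
    -- Only finitely many variables matter, so the induction hypothesis at the largest of them
    -- applies. If there are none, satisfiability by any tuple is enough.
    have hlt : ∀ φ ∈ Φ, DependsOnlyOn e (Set.Iio i) φ → φ.Realize (Sum.elim e b) := by
      intro φ hφ hd
      obtain ⟨s, hs⟩ := exists_finset_dependsOnlyOn e φ
      have hst := hs.inter hd
      by_cases hne : (s.filter (· < i)).Nonempty
      · have hm := Finset.mem_filter.1 ((s.filter (· < i)).max'_mem hne)
        refine IH _ hm.2 φ hφ (hst.mono fun j hj => ?_)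
        exact Finset.le_max' _ _ (Finset.mem_filter.2 hj)
      · obtain ⟨b₀, hb₀⟩ := hsat φ hφ
        refine (hst b₀ b fun j hj => ?_).1 hb₀
        exact (hne ⟨j, Finset.mem_filter.2 hj⟩).elim
    -- one more element can be found by saturation
    have hex : ∃ c : N, ∀ φ ∈ Φ, DependsOnlyOn e (Set.Iic i) φ →
        φ.Realize (Sum.elim e fun j => if j < i then b j else c) := by
      have hone : ∀ φ ∈ Φ, DependsOnlyOn e (Set.Iic i) φ →
          ∃ c, φ.Realize (Sum.elim e fun j => if j < i then b j else c) := by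
        intro φ hφ hd
        -- By completeness the alternative is that `Φ` contains the negation, which is not
        -- satisfiable together with `φ`.
        have hmem : exAt i φ ∈ Φ := by
          refine (hcompl _).resolve_right fun hnot => ?_
          obtain ⟨b₀, hb₀⟩ := hsat _ (hinf _ hφ _ hnot)
          rw [Formula.realize_inf, Formula.realize_not, realize_exAt] at hb₀
          exact hb₀.2 ⟨b₀ i, by rw [Function.update_eq_self]; exact hb₀.1⟩
        have hdep : DependsOnlyOn e (Set.Iio i) (exAt i φ) := by
          intro b₁ b₂ h
          rw [realize_exAt, realize_exAt]
          refine exists_congr fun c => hd _ _ fun j hj => ?_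
          rcases eq_or_lt_of_le hj with rfl | hj
          · simp
          · simp [hj.ne, h j hj]
        obtain ⟨c, hc⟩ := (realize_exAt i φ e b).1 (hlt _ hmem hdep)
        refine ⟨c, (hd _ _ fun j hj => ?_).1 hc⟩
        rcases eq_or_lt_of_le hj with rfl | hj
        · simp
        · simp [hj.ne, hj]
      let A : Set N := Set.range e ∪ Set.range b
      have hA : #A < κ := by
        refine (mk_union_le _ _).trans_lt (add_lt_of_lt hκ he ?_)
        have := (mk_range_le_lift (f := b)).trans_lt hβ
        exact lift_lt.1 this
      let g : α ⊕ β → A ⊕ Unit := Sum.elim (fun a => Sum.inl ⟨e a, Or.inl ⟨a, rfl⟩⟩)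
        fun j => if j < i then Sum.inl ⟨b j, Or.inr ⟨j, rfl⟩⟩ else Sum.inr ()
      have hg : ∀ c : N, (Sum.elim Subtype.val fun _ => c : A ⊕ Unit → N) ∘ g =
          Sum.elim e fun j => if j < i then b j else c := by
        intro c
        funext j
        rcases j with j | j
        · rfl
        · by_cases h : j < i <;> simp [g, h]
      have hfs : ∀ Γ₀ : Finset (L.Formula (A ⊕ Unit)), (Γ₀ : Set (L.Formula (A ⊕ Unit))) ⊆
          {ψ | ∃ φ ∈ Φ, DependsOnlyOn e (Set.Iic i) φ ∧ φ.relabel g = ψ} →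
          ∃ c : N, ∀ ψ ∈ Γ₀, ψ.Realize (Sum.elim Subtype.val fun _ => c) := by
        intro Γ₀ hΓ₀
        have : ∃ φ ∈ Φ, DependsOnlyOn e (Set.Iic i) φ ∧ ∀ c : N,
            φ.Realize (Sum.elim e fun j => if j < i then b j else c) →
            ∀ ψ ∈ Γ₀, ψ.Realize (Sum.elim Subtype.val fun _ => c) := by
          induction Γ₀ using Finset.induction_on with
          | empty =>
            refine ⟨⊤, (hcompl ⊤).resolve_right fun h => ?_, fun _ _ _ => Iff.rfl, by simp⟩
            obtain ⟨b₀, hb₀⟩ := hsat _ h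
            rw [Formula.realize_not] at hb₀
            exact hb₀ (Formula.realize_top.2 trivial)
          | insert ψ Γ₀ _ ih =>
            rw [Finset.coe_insert, Set.insert_subset_iff] at hΓ₀
            obtain ⟨φ, hφ, hd, hr⟩ := ih hΓ₀.2
            obtain ⟨φ', hφ', hd', rfl⟩ := hΓ₀.1
            refine ⟨φ' ⊓ φ, hinf _ hφ' _ hφ, fun b₁ b₂ h => ?_, fun c hc ψ hψ => ?_⟩
            · rw [Formula.realize_inf, Formula.realize_inf, hd _ _ h, hd' _ _ h]
            · rw [Formula.realize_inf] at hc
              rcases Finset.mem_insert.1 hψ with rfl | hψ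
              · rw [Formula.realize_relabel, hg]
                exact hc.1
              · exact hr c hc.2 ψ hψ
        obtain ⟨φ, hφ, hd, hr⟩ := this
        obtain ⟨c, hc⟩ := hone φ hφ hd
        exact ⟨c, hr c hc⟩
      obtain ⟨c, hc⟩ := hN A hA _ hfs
      refine ⟨c, fun φ hφ hd => ?_⟩
      have := hc _ ⟨φ, hφ, hd, rfl⟩
      rwa [Formula.realize_relabel, hg] at this
    intro φ hφ hd
    have hspec := Classical.epsilon_spec hex φ hφ hd
    have hbi : b i = Classical.epsilon fun c => ∀ φ ∈ Φ, DependsOnlyOn e (Set.Iic i) φ →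
        φ.Realize (Sum.elim e fun j => if j < i then b j else c) := by
      rw [hb i]
      simp only [F, dite_eq_ite]
    rw [← hbi] at hspec
    refine (hd _ _ fun j hj => ?_).1 hspec
    rcases eq_or_lt_of_le hj with rfl | hj
    · simp
    · simp [hj]
  refine ⟨b, fun φ hφ => ?_⟩
  obtain ⟨s, hs⟩ := exists_finset_dependsOnlyOn e φ
  by_cases hne : s.Nonempty
  · exact key (s.max' hne) φ hφ (hs.mono fun j hj => Finset.le_max' _ _ hj)
  · obtain ⟨b₀, hb₀⟩ := hsat φ hφ
    exact (hs b₀ b fun j hj => (hne ⟨j, hj⟩).elim).1 hb₀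

end Saturation

/-! ### Keisler measures as regular Borel measures -/

section Borel

variable {L : FirstOrder.Language.{u, v}} {C : Type w} [L.Structure C] {A : Set C} {ι : Type x}

theorem mem_solutionSet (φ : L.Formula (A ⊕ ι)) (a : ι → C) :
    a ∈ solutionSet φ ↔ φ.Realize (Sum.elim Subtype.val a) := Iff.rfl

theorem solutionSet_eq_iff {φ ψ : L.Formula (A ⊕ ι)} : solutionSet φ = solutionSet ψ ↔
    ∀ a : ι → C, φ.Realize (Sum.elim Subtype.val a) ↔ ψ.Realize (Sum.elim Subtype.val a) :=
  ⟨fun h a => by rw [← mem_solutionSet, h, mem_solutionSet], fun h => SetLike.ext h⟩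

theorem solutionSet_sup (φ ψ : L.Formula (A ⊕ ι)) :
    solutionSet (φ ⊔ ψ) = solutionSet φ ⊔ solutionSet ψ :=
  SetLike.ext fun a => by
    rw [DefinableSet.mem_sup, mem_solutionSet, mem_solutionSet, mem_solutionSet,
      Formula.realize_sup]

theorem exists_solutionSet_eq (X : L.DefinableSet A ι) :
    ∃ φ : L.Formula (A ⊕ ι), solutionSet φ = X := by
  obtain ⟨φ, hφ⟩ := Set.definable_iff_exists_formula_sum.1 X.2
  exact ⟨φ, Subtype.ext hφ.symm⟩

theorem definableSet_disjoint_iff {X Y : L.DefinableSet A ι} :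
    Disjoint X Y ↔ ∀ a : ι → C, a ∈ X → a ∉ Y := by
  rw [disjoint_iff, ← SetLike.coe_set_eq, DefinableSet.coe_inf, DefinableSet.coe_bot,
    ← Set.disjoint_iff_inter_eq_empty, Set.disjoint_left]
  rfl

namespace KeislerMeasure

variable (μ : KeislerMeasure L C A ι)

theorem mono {X Y : L.DefinableSet A ι} (h : X ≤ Y) : μ X ≤ μ Y := by
  rw [← sup_sdiff_cancel_right h, μ.additive _ _ disjoint_sdiff_self_right]
  linarith [μ.nonneg (Y \ X)]

theorem le_one (X : L.DefinableSet A ι) : μ X ≤ 1 :=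
  μ.top_eq_one ▸ μ.mono le_top

theorem ext {μ ν : KeislerMeasure L C A ι} (h : ∀ X, μ X = ν X) : μ = ν := by
  cases μ
  cases ν
  congr
  exact funext h

end KeislerMeasure

/-- Regular Borel measures on type spaces which agree on formulas are equal. -/
theorem regular_measure_ext_contains {η η' : Measure (TypeSpace L C A ι)} [η.Regular]
    [η'.Regular] (h : ∀ φ : L.Formula (A ⊕ ι), η {p | Contains p φ} = η' {p | Contains p φ}) :
    η = η' :=
  regular_measure_ext fun U => by
    obtain ⟨φ, rfl⟩ := exists_clopenOf_eq U
    exact h φ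

theorem typesExtending_eq_iInter (m : ι → C) : typesExtending L m =
    ⋂ φ : {φ : L.Formula ι // φ.Realize m},
      (clopenOf (C := C) (A := Set.univ) (φ.1.relabel Sum.inr) : Set _) := by
  ext p
  simp only [Set.mem_iInter, Subtype.forall]
  rfl

theorem isClosed_typesExtending (m : ι → C) : IsClosed (typesExtending L m) := by
  rw [typesExtending_eq_iInter]
  exact isClosed_iInter fun φ => (clopenOf _).isClopen.isClosed

theorem measurableEmbedding_typesExtending (a : ι → C) :
    MeasurableEmbedding (Subtype.val : typesExtending L a → TypeSpace L C Set.univ ι) :=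
  MeasurableEmbedding.subtype_coe (isClosed_typesExtending a).measurableSet

theorem isProbabilityMeasure_comap {a : ι → C} {ν : GlobalMeasure L C ι}
    (hν : ConcentratesOn a ν) : IsProbabilityMeasure
      ((borelMeasure ν).comap (Subtype.val : typesExtending L a → _)) := by
  refine ⟨?_⟩
  rw [(measurableEmbedding_typesExtending a).comap_apply, Set.image_univ, Subtype.range_coe]
  exact hν

variable [Nonempty C]

theorem solutionSet_eq_of_clopenOf_eq {φ ψ : L.Formula (A ⊕ ι)}
    (h : clopenOf (C := C) φ = clopenOf ψ) : solutionSet (C := C) φ = solutionSet ψ := by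
  refine solutionSet_eq_iff.2 fun a => ?_
  rw [← contains_tpOver, ← contains_tpOver]
  exact iff_of_eq (congrArg (fun U : TopologicalSpace.Clopens _ => tpOver A a ∈ U) h)

/-- Clopen sets correspond to formulas up to equivalence in `C`, since tuples of `C` already
distinguish inequivalent formulas. So `μ` is a finitely additive function of clopen sets, and the
extension theorem applies. -/
theorem exists_isBorelExtension (μ : KeislerMeasure L C A ι) : ∃ η, IsBorelExtension μ η := by
  choose φ hφ using exists_clopenOf_eq (L := L) (C := C) (A := A) (ι := ι)
  have hval : ∀ ψ : L.Formula (A ⊕ ι), solutionSet (C := C) (φ (clopenOf ψ)) = solutionSet ψ :=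
    fun ψ => solutionSet_eq_of_clopenOf_eq (hφ _)
  obtain ⟨η, hη, h⟩ := exists_regular_measure_of_clopens
    (fun U => (⟨μ (solutionSet (φ U)), μ.nonneg _⟩ : NNReal)) fun U V hUV => by
      have hUV' : clopenOf (φ U ⊔ φ V) = U ⊔ V := by
        conv_rhs => rw [← hφ U, ← hφ V]
        exact TopologicalSpace.Clopens.ext (Set.ext fun p => contains_sup p _ _)
      refine NNReal.eq ?_
      change μ _ = μ _ + μ _
      rw [← μ.additive, ← solutionSet_sup, ← hUV', hval]
      refine definableSet_disjoint_iff.2 fun a ha hb => ?_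
      rw [mem_solutionSet, ← contains_tpOver] at ha hb
      have ha' : tpOver A a ∈ U := by rw [← hφ U]; exact ha
      have hb' : tpOver A a ∈ V := by rw [← hφ V]; exact hb
      have : tpOver A a ∈ U ⊓ V := ⟨ha', hb'⟩
      rw [hUV.eq_bot] at this
      exact this
  refine ⟨η, hη, fun ψ => (h (clopenOf ψ)).trans ?_⟩
  rw [ENNReal.ofReal, Real.toNNReal_of_nonneg (μ.nonneg _)]
  exact congrArg _ (NNReal.eq (congrArg μ.toFun (hval ψ)))

theorem isBorelExtension_borelMeasure (μ : KeislerMeasure L C A ι) :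
    IsBorelExtension μ (borelMeasure μ) :=
  Classical.epsilon_spec (exists_isBorelExtension μ)

instance (μ : KeislerMeasure L C A ι) : (borelMeasure μ).Regular :=
  (isBorelExtension_borelMeasure μ).1

theorem borelMeasure_contains (μ : KeislerMeasure L C A ι) (φ : L.Formula (A ⊕ ι)) :
    borelMeasure μ {p | Contains p φ} = ENNReal.ofReal (μ (solutionSet φ)) :=
  (isBorelExtension_borelMeasure μ).2 φ

instance (μ : KeislerMeasure L C A ι) : IsProbabilityMeasure (borelMeasure μ) := by
  refine ⟨?_⟩
  have h := borelMeasure_contains μ ⊤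
  have h1 : {p : TypeSpace L C A ι | Contains p ⊤} = Set.univ :=
    Set.eq_univ_of_forall fun p => contains_of_forall fun a => Formula.realize_top.2 trivial
  have h2 : solutionSet (C := C) (⊤ : L.Formula (A ⊕ ι)) = ⊤ :=
    SetLike.ext fun a => by simp [mem_solutionSet]
  rw [h1, h2, μ.top_eq_one, ENNReal.ofReal_one] at h
  exact h

/-- A global measure concentrates on `tp(m/∅)` if and only if each formula in this type has
measure one. -/
theorem concentratesOn_iff {m : ι → C} {μ : GlobalMeasure L C ι} : ConcentratesOn m μ ↔
    ∀ φ : L.Formula ι, φ.Realize m → μ (solutionSet (φ.relabel Sum.inr)) = 1 := by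
  rw [ConcentratesOn, ← prob_compl_eq_zero_iff (isClosed_typesExtending m).measurableSet]
  have hiff : ∀ φ : L.Formula ι, μ (solutionSet (φ.relabel Sum.inr)) = 1 ↔
      borelMeasure μ
        (clopenOf (C := C) (A := Set.univ) (φ.relabel Sum.inr) : Set _)ᶜ = 0 := fun φ => by
    rw [prob_compl_eq_zero_iff (clopenOf _).isClopen.isClosed.measurableSet]
    have := borelMeasure_contains μ (φ.relabel Sum.inr)
    change _ ↔ borelMeasure μ {p | Contains p (φ.relabel Sum.inr)} = 1
    rw [this, ENNReal.ofReal_eq_one]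
  simp only [hiff]
  rw [typesExtending_eq_iInter]
  refine ⟨fun h φ hφ => measure_mono_null ?_ h, fun h =>
    measure_iInter_clopens_compl_eq_zero _ fun φ => h φ.1 φ.2⟩
  exact Set.compl_subset_compl.2 fun p hp => Set.mem_iInter.1 hp ⟨φ, hφ⟩

end Borel

/-- The image under a continuous map of the restriction of a finite regular measure to a closed
subset is regular. -/
theorem regular_map_comap_subtype {X Y : Type*} [TopologicalSpace X] [MeasurableSpace X]
    [BorelSpace X] [T2Space X] [TopologicalSpace Y] [MeasurableSpace Y] [BorelSpace Y]
    [R1Space Y]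
    (η : Measure X) [η.Regular] [IsFiniteMeasure η] {S : Set X} (hS : IsClosed S) {h : S → Y}
    (hh : Continuous h) : ((η.comap (Subtype.val : S → X)).map h).Regular := by
  have hemb : MeasurableEmbedding (Subtype.val : S → X) :=
    MeasurableEmbedding.subtype_coe hS.measurableSet
  have hfin : IsFiniteMeasure (η.comap (Subtype.val : S → X)) :=
    ⟨by rw [hemb.comap_apply]; exact measure_lt_top _ _⟩
  -- For a finite measure on an `R1Space`, inner regularity on measurable sets by compact sets
  -- already yields regularity. The compact sets needed are the images under `h` of compact sets
  -- inside the preimage.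
  suffices ((η.comap (Subtype.val : S → X)).map h).InnerRegularCompactLTTop from inferInstance
  refine ⟨fun U hU r hr => ?_⟩
  rw [Measure.map_apply hh.measurable hU.1, hemb.comap_apply] at hr
  obtain ⟨K, hKU, hK, hrK⟩ := (hemb.measurableSet_image.2
    (hh.measurable hU.1)).exists_lt_isCompact_of_ne_top (measure_ne_top _ _) hr
  have hKS : K ⊆ S := hKU.trans (Subtype.coe_image_subset S _)
  have hK' : IsCompact ((Subtype.val : S → X) ⁻¹' K) :=
    hS.isClosedEmbedding_subtypeVal.isCompact_preimage hK
  refine ⟨h '' (Subtype.val ⁻¹' K), ?_, hK'.image hh, hrK.trans_le ?_⟩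
  · rintro _ ⟨s, hs, rfl⟩
    obtain ⟨s', hs', h'⟩ := hKU hs
    rw [Subtype.ext h'] at hs'
    exact hs'
  · refine le_trans ?_ (Measure.le_map_apply hh.measurable.aemeasurable _)
    rw [hemb.comap_apply]
    refine measure_mono fun x hx => ⟨⟨x, hKS hx⟩, ⟨_, hx, rfl⟩, rfl⟩

/-! ### The maps `h_b` -/

section Plug

variable {L : FirstOrder.Language.{u, v}} {C : Type w} {ι β : Type w}

/-- The formula `φ(b; y)` with parameters from `C`. -/
def plug (φ : L.Formula (β ⊕ ι)) (b : β → C) : L.Formula ((Set.univ : Set C) ⊕ ι) :=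
  φ.relabel (Sum.map (fun i => ⟨b i, Set.mem_univ (b i)⟩) id)

theorem realize_plug {N : Type*} [L.Structure N] (e : C → N) (φ : L.Formula (β ⊕ ι)) (b : β → C)
    (a : ι → N) : (plug φ b).Realize (Sum.elim (fun c => e c) a) ↔
      φ.Realize (Sum.elim (fun i => e (b i)) a) := by
  rw [plug, Formula.realize_relabel]
  refine iff_of_eq (congrArg φ.Realize ?_)
  funext i
  rcases i with i | i <;> rfl

end Plug

/-! ### Conjugates of tuples and the syntactic form of `h_b`. -/

section Conjugates

variable {L : FirstOrder.Language.{u, v}} {C : Type w} [L.Structure C]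
  {M : L.ElementarySubstructure C} {ι : Type w} {β γ : Type w}

/-- For a formula `φ(x)` over `M`, the formula `φ*(x; y)` over `∅` with `φ(x) = φ*(x; m)`. -/
def dual (m : ι ≃ M) (φ : L.Formula ((M : Set C) ⊕ β)) : L.Formula (β ⊕ ι) :=
  φ.relabel (Sum.elim (fun c => Sum.inr (m.symm c)) Sum.inl)

theorem solutionSet_plug (φ : L.Formula (β ⊕ ι)) (b : β → C) :
    solutionSet (plug φ b) = fiber φ b := rfl

theorem realize_dual {N : Type*} [L.Structure N] (m : ι ≃ M) (φ : L.Formula ((M : Set C) ⊕ β))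
    (b : β → N) (a : ι → N) : (dual m φ).Realize (Sum.elim b a) ↔
      φ.Realize (Sum.elim (fun c => a (m.symm c)) b) := by
  rw [dual, Formula.realize_relabel]
  refine iff_of_eq (congrArg φ.Realize ?_)
  funext i
  rcases i with i | i <;> rfl

theorem realize_dual_tuple (m : ι ≃ M) (φ : L.Formula ((M : Set C) ⊕ β)) (b : β → C) :
    (dual m φ).Realize (Sum.elim b (tuple m)) ↔ φ.Realize (Sum.elim Subtype.val b) := by
  rw [realize_dual]
  refine iff_of_eq (congrArg φ.Realize ?_)
  funext i
  rcases i with i | i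
  · exact congrArg Subtype.val (m.apply_symm_apply i)
  · rfl

/-- For `p = tp(σ(m)/C)`, the tuple `c` has the type over `M` of `σ⁻¹(b)`. -/
def IsConjugate (m : ι ≃ M) (p : TypeSpace L C Set.univ ι) (b c : β → C) : Prop :=
  ∀ φ : L.Formula (β ⊕ ι), Contains p (plug φ b) ↔ φ.Realize (Sum.elim c (tuple m))

/-- A realization of a type in `S_m(C)` in an elementary extension. -/
theorem exists_realization_of_mem_typesExtending {a₀ : ι → C} {p : TypeSpace L C Set.univ ι}
    (hp : p ∈ typesExtending L a₀) :
    ∃ (N : Type (max u v w)) (_ : L.Structure N) (_ : Nonempty N) (e : C → N) (a : ι → N),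
      (∀ (φ : L.Formula β) (b : β → C), φ.Realize b ↔ φ.Realize (fun i => e (b i))) ∧
      (∀ (φ : L.Formula (β ⊕ ι)) (b : β → C),
        Contains p (plug φ b) ↔ φ.Realize (Sum.elim (fun i => e (b i)) a)) ∧
      ∀ φ : L.Formula ι, φ.Realize a₀ ↔ φ.Realize a := by
  obtain ⟨N, _, _, e, a, he, h⟩ := exists_realization p
  refine ⟨N, inferInstance, inferInstance, fun c => e ⟨c, Set.mem_univ c⟩, a, fun φ b => ?_,
    fun φ b => ?_, ?_⟩
  · have := he (φ.relabel fun i => ⟨b i, Set.mem_univ _⟩)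
    rwa [Formula.realize_relabel, Formula.realize_relabel] at this
  · rw [h]
    exact realize_plug (fun c => e ⟨c, Set.mem_univ c⟩) φ b a
  · have key : ∀ φ : L.Formula ι, φ.Realize a₀ → φ.Realize a := fun φ hφ => by
      have := (h _).1 (hp φ hφ)
      rwa [Formula.realize_relabel] at this
    refine fun φ => ⟨key φ, fun hφ => ?_⟩
    by_contra hφ'
    exact key φ.not hφ' hφ

section

variable {m : ι ≃ M} {p : TypeSpace L C Set.univ ι} (hp : p ∈ typesExtending L (tuple m))
include hp

/-- If `a` realizes `p` in an elementary extension, then `a` has the type of `m` over `∅`. Each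
formula true of `a` and `b` is therefore satisfiable with `m` in place of `a`, and saturation finds
the conjugate in `C` itself. -/
theorem exists_isConjugate [Nonempty C] {κ : Cardinal.{w}} (hC : IsSaturated L C κ) (hκ : ℵ₀ ≤ κ)
    (hι : #ι < κ) (hβ : #β < κ) (b : β → C) : ∃ c : β → C, IsConjugate m p b c := by
  have hswap : ∀ {N : Type w} (c : β → N) (a : ι → N), Sum.elim a c ∘ Sum.swap = Sum.elim c a :=
    fun c a => by
      funext i
      rcases i with i | i <;> rfl
  obtain ⟨N, _, _, e, a, -, h, ha⟩ := exists_realization_of_mem_typesExtending (β := β) hp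
  obtain ⟨c, hc⟩ := hC.exists_realize hκ (tuple m) (mk_range_le.trans_lt hι) (by simpa using hβ)
    {φ : L.Formula (ι ⊕ β) | φ.Realize (Sum.elim a fun i => e (b i))} (fun φ => Classical.em _)
    (fun φ hφ ψ hψ => Formula.realize_inf.2 ⟨hφ, hψ⟩)
    (fun φ hφ => (realize_exOver _ _).1 ((ha _).2 ((realize_exOver _ _).2 ⟨_, hφ⟩)))
  have key : ∀ φ : L.Formula (β ⊕ ι), Contains p (plug φ b) →
      φ.Realize (Sum.elim c (tuple m)) := fun φ hφ => by
    rw [h] at hφ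
    have := hc (φ.relabel Sum.swap) (by
      change (φ.relabel Sum.swap).Realize _
      rw [Formula.realize_relabel]
      convert hφ using 1
      funext i
      rcases i with i | i <;> rfl)
    rwa [Formula.realize_relabel, hswap] at this
  refine ⟨c, fun φ => ⟨key φ, fun hφ => ?_⟩⟩
  by_contra hφ'
  refine key φ.not ?_ hφ
  rw [h, Formula.realize_not, ← h]
  exact hφ'

theorem IsConjugate.realize_iff [Nonempty C] {b c : β → C} (h : IsConjugate m p b c)
    (θ : L.Formula β) : θ.Realize b ↔ θ.Realize c := by
  obtain ⟨N, _, _, e, a, hb, hp, -⟩ := exists_realization_of_mem_typesExtending (β := β) hp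
  have h1 := h (θ.relabel Sum.inl)
  rw [hp, Formula.realize_relabel, Formula.realize_relabel, Sum.elim_comp_inl,
    Sum.elim_comp_inl] at h1
  exact (hb θ b).trans h1

/-- That `φ(b; C)` and `ψ(b; C)` coincide is a first-order property of `b` without parameters, and
conjugates have the same type over `∅`. -/
theorem IsConjugate.fiber_eq [Nonempty C] {b c : β → C} (h : IsConjugate m p b c)
    {φ ψ : L.Formula (β ⊕ γ)} (hφ : fiber φ b = fiber ψ b) : fiber φ c = fiber ψ c := by
  have hex : ∀ a : β → C, fiber φ a = fiber ψ a ↔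
      ¬ (exOver ((φ ⊓ ψ.not) ⊔ (ψ ⊓ φ.not))).Realize a := fun a => by
    rw [realize_exOver]
    push Not
    refine ⟨fun h e => ?_, fun h => SetLike.ext fun e => ?_⟩
    · have := SetLike.ext_iff.1 h e
      rw [mem_fiber, mem_fiber] at this
      simp only [Formula.realize_sup, Formula.realize_inf, Formula.realize_not]
      tauto
    · have := h e
      rw [mem_fiber, mem_fiber]
      simp only [Formula.realize_sup, Formula.realize_inf, Formula.realize_not] at this
      tauto
  rw [hex] at hφ ⊢
  rwa [← h.realize_iff hp]

end

/-- Subtuples of conjugates are conjugates, so several tuples can be conjugated simultaneously by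
concatenating them. -/
theorem IsConjugate.comp [Nonempty C] {m : ι ≃ M} {p : TypeSpace L C Set.univ ι} {b c : β → C}
    (h : IsConjugate m p b c) (g : γ → β) : IsConjugate m p (b ∘ g) (c ∘ g) := by
  intro φ
  have h1 := h (φ.relabel (Sum.map g id))
  rw [Formula.realize_relabel] at h1
  have h2 : Contains p (plug (φ.relabel (Sum.map g id)) b) ↔ Contains p (plug φ (b ∘ g)) :=
    contains_congr fun a => by
      refine (realize_plug id _ b a).trans (Iff.trans ?_ (realize_plug id _ _ a).symm)
      rw [Formula.realize_relabel]
      refine iff_of_eq (congrArg φ.Realize ?_)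
      funext i
      rcases i with i | i <;> rfl
  rw [h2] at h1
  refine h1.trans (iff_of_eq (congrArg φ.Realize ?_))
  funext i
  rcases i with i | i <;> rfl

/-- Formulas over `M` are formulas `φ*(x; m)`, whose truth at a conjugate is dictated by `p` and
`b`. -/
theorem IsConjugate.sameType {m : ι ≃ M} {p : TypeSpace L C Set.univ ι} {b c c' : β → C}
    (h : IsConjugate m p b c) (h' : IsConjugate m p b c') : SameType L (M : Set C) c c' := by
  intro φ
  rw [← realize_dual_tuple m, ← realize_dual_tuple m, ← h, h']

/-- The map `h_b` for tuples `b` of arbitrary small length. -/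
noncomputable def conjugateType [Nonempty C] (m : ι ≃ M) (b : β → C)
    (p : typesExtending L (tuple m)) : TypeSpace L C (M : Set C) β :=
  tpOver M (Classical.epsilon fun c => IsConjugate m p.1 b c)

variable [Nonempty C] {κ : Cardinal.{w}} (hC : IsSaturated L C κ) (hκ : ℵ₀ ≤ κ) (hι : #ι < κ)
  (hβ : #β < κ) (m : ι ≃ M) (b : β → C)

section
include hC hκ hι hβ

/-- The value of `h_b` at `p` is the type of a conjugate of `b`. -/
theorem exists_isConjugate_and_conjugateType_eq (p : typesExtending L (tuple m)) :
    ∃ c : β → C, IsConjugate m p.1 b c ∧ conjugateType m b p = tpOver M c :=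
  ⟨_, Classical.epsilon_spec (exists_isConjugate p.2 hC hκ hι hβ b), rfl⟩

/-- This description of `h_b` replaces automorphisms. It makes preimages of basic clopen sets traces
of basic clopen sets, whence continuity, and it computes the pushforward of `ν` on formulas. -/
theorem contains_conjugateType (p : typesExtending L (tuple m))
    (φ : L.Formula ((M : Set C) ⊕ β)) :
    Contains (conjugateType m b p) φ ↔ Contains p.1 (plug (dual m φ) b) := by
  obtain ⟨c, hc, h⟩ := exists_isConjugate_and_conjugateType_eq hC hκ hι hβ m b p
  rw [h, contains_tpOver, hc, realize_dual_tuple]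

theorem continuous_conjugateType : Continuous (conjugateType (L := L) m b) := by
  refine isTopologicalBasis_contains.continuous_iff.2 ?_
  rintro _ ⟨φ, rfl⟩
  have : conjugateType m b ⁻¹' {q | Contains q φ} =
      Subtype.val ⁻¹' {p | Contains p (plug (dual m φ) b)} :=
    Set.ext fun p => contains_conjugateType hC hκ hι hβ m b p φ
  rw [this]
  exact (isClopen_contains _).isOpen.preimage continuous_subtype_val

end

end Conjugates

/-! ### Comparison with automorphisms of the larger monster model. -/

section LargerMonster

variable {L : FirstOrder.Language.{u, v}} {C : Type w} [L.Structure C] [Infinite C]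
  {M : L.ElementarySubstructure C} {ι : Type w} {C' : Type w'} [L.Structure C']
  {κ' : Cardinal.{w'}} (hC' : IsMonster L C' κ') (j : C ↪ₑ[L] C') (hj : #(Set.range j) < κ')
  (m : ι ≃ M)
include hC' hj

/-- Saturation of `C'` realizes `p` by some tuple. It has the type of `m` over `∅`, so homogeneity
moves `m` onto it. -/
theorem exists_automorphism_realizes (p : typesExtending L (tuple m)) :
    ∃ σ : C' ≃[L] C', Realizes j (fun i => σ (j (tuple m i))) p.1 := by
  have hκ' : ℵ₀ ≤ κ' := by
    have : Infinite (Set.range j) := Set.infinite_coe_iff.2 (Set.infinite_range_of_injective j.injective)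
    exact (aleph0_le_mk _).trans hj.le
  have hjm : Function.Injective fun i => j (tuple m i) := fun i i' h =>
    m.injective (Subtype.ext (j.injective h))
  have hι : Cardinal.lift.{w'} #ι < Cardinal.lift.{w} κ' := by
    rw [← mk_range_eq_of_injective hjm, lift_lt]
    refine (mk_le_mk_of_subset ?_).trans_lt hj
    rintro _ ⟨i, rfl⟩
    exact ⟨_, rfl⟩
  have : Nonempty C' := ⟨j (Classical.arbitrary C)⟩
  obtain ⟨a, ha⟩ := hC'.saturated.exists_realize hκ' (fun c : (Set.univ : Set C) => j c)
    ((mk_le_mk_of_subset (by rintro _ ⟨c, rfl⟩; exact ⟨_, rfl⟩)).trans_lt hj) hι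
    {φ | Contains p.1 φ}
    (fun φ => (Classical.em (Contains p.1 φ)).imp id (contains_not p.1 φ).2)
    (fun φ hφ ψ hψ => (contains_inf p.1 φ ψ).2 ⟨hφ, hψ⟩)
    (fun φ hφ => by
      obtain ⟨a, ha⟩ := exists_realize_of_contains hφ
      refine ⟨fun i => j (a i), ?_⟩
      rw [← j.map_formula] at ha
      convert ha using 1
      funext i
      rcases i with i | i <;> rfl)
  have hreal : Realizes j a p.1 := fun φ => ⟨fun h => ha φ h, fun h => by
    by_contra hφ
    exact ha φ.not ((contains_not p.1 φ).2 hφ) h⟩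
  have htp : ∀ φ : L.Formula ι, φ.Realize (fun i => j (tuple m i)) → φ.Realize a := fun φ hφ => by
    have := (hreal _).1 (p.2 φ ((j.map_formula φ (tuple m)).1 hφ))
    rwa [Formula.realize_relabel] at this
  let g : Set.range (fun i => j (tuple m i)) → ι := (Equiv.ofInjective _ hjm).symm
  have hg : (Subtype.val : Set.range (fun i => j (tuple m i)) → C') =
      (fun i => j (tuple m i)) ∘ g :=
    funext fun x => (congrArg Subtype.val ((Equiv.ofInjective _ hjm).apply_symm_apply x)).symm
  obtain ⟨σ, hσ⟩ := hC'.homogeneous (Set.range fun i => j (tuple m i))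
    ((mk_le_mk_of_subset (by rintro _ ⟨c, rfl⟩; exact ⟨_, rfl⟩)).trans_lt hj) (a ∘ g) fun φ => by
      rw [hg, ← Formula.realize_relabel, ← Formula.realize_relabel]
      -- Preservation of formulas in one direction suffices, applied also to negations.
      refine ⟨htp _, fun h => ?_⟩
      by_contra h'
      exact htp (φ.relabel g).not h' h
  refine ⟨σ, ?_⟩
  have : (fun i => σ (j (tuple m i))) = a := funext fun i => by
    have := hσ ⟨j (tuple m i), i, rfl⟩
    rw [this]
    exact congrArg a ((Equiv.ofInjective _ hjm).symm_apply_apply i)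
  rwa [this]

/-- The map `h_b`, defined by automorphisms of the larger monster model, agrees with its syntactic
description. -/
theorem hMap_eq_conjugateType {κ : Cardinal.{w}} (hC : IsSaturated L C κ) (hκ : ℵ₀ ≤ κ)
    (hι : #ι < κ) (b : ι → C) : hMap j m b = conjugateType m b := by
  funext p
  -- Apply `σ⁻¹`: `φ*(b; σ(m))` holds iff `φ*(σ⁻¹(b); m)` does. In particular the type of `σ⁻¹(b)`
  -- over `M` does not depend on `σ`.
  have key : ∀ (σ : C' ≃[L] C') (φ : L.Formula ((M : Set C) ⊕ ι)),
      Realizes j (fun i => σ (j (tuple m i))) p.1 →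
      (Contains p.1 (plug (dual m φ) b) ↔
        φ.Realize (Sum.elim (fun c => j c) fun i => σ.symm (j (b i)))) := by
    intro σ φ hσ
    rw [hσ, realize_plug, realize_dual, ← StrongHomClass.realize_formula σ φ
      (v := Sum.elim (fun c => j c) fun i => σ.symm (j (b i)))]
    refine iff_of_eq (congrArg φ.Realize ?_)
    funext i
    rcases i with i | i
    · simp [tuple]
    · simp
  have hex : ∃ q : TypeSpace L C (M : Set C) ι, ∃ σ : C' ≃[L] C',
      Realizes j (fun i => σ (j (tuple m i))) p.1 ∧
      Realizes j (fun i => σ.symm (j (b i))) q := by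
    obtain ⟨σ, hσ⟩ := exists_automorphism_realizes hC' j hj m p
    exact ⟨conjugateType m b p, σ, hσ, fun φ => by
      rw [contains_conjugateType hC hκ hι hι, key σ φ hσ]⟩
  obtain ⟨σ, hσ, hq⟩ := Classical.epsilon_spec hex
  refine typeSpace_ext fun φ => ?_
  rw [contains_conjugateType hC hκ hι hι, key σ φ hσ]
  exact hq φ

end LargerMonster

/-! ### The convolution product -/

section FiberMap

variable {L : FirstOrder.Language.{u, v}} {C : Type w} [L.Structure C] [Nonempty C]
  {M : L.ElementarySubstructure C} {ι : Type w} {β γ : Type w}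

theorem fiberMap_nonneg (μ : GlobalMeasure L C ι) (φ : L.Formula (β ⊕ ι))
    (q : TypeSpace L C (M : Set C) β) : 0 ≤ fiberMap M μ φ q := μ.nonneg _

theorem fiberMap_le_one (μ : GlobalMeasure L C ι) (φ : L.Formula (β ⊕ ι))
    (q : TypeSpace L C (M : Set C) β) : fiberMap M μ φ q ≤ 1 := μ.le_one _

/-- `fiberMap` evaluates at an arbitrarily chosen realization; invariance makes the choice
immaterial. -/
theorem fiberMap_tpOver {κ : Cardinal.{w}} {μ : GlobalMeasure L C ι}
    (hμ : IsInvariantOver κ M μ) (hβ : #β < κ) (φ : L.Formula (β ⊕ ι)) (c : β → C) :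
    fiberMap M μ φ (tpOver M c) = μ (fiber φ c) := by
  have h : ∃ b : β → C, Realizes (L := L) id b (tpOver (M : Set C) c) := ⟨c, realizes_tpOver c⟩
  refine hμ β hβ φ _ _ fun ψ => ?_
  exact (Classical.epsilon_spec h ψ).symm.trans (contains_tpOver c ψ)

/-- By saturation, statements about all types over a small set can be checked on types of tuples of
`C`. -/
theorem exists_tpOver_eq {κ : Cardinal.{w}} (hC : IsSaturated L C κ) (hκ : ℵ₀ ≤ κ) {A : Set C}
    (hA : #A < κ) (hβ : #β < κ) (q : TypeSpace L C A β) : ∃ c : β → C, tpOver A c = q := by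
  obtain ⟨c, hc⟩ := hC.exists_realize hκ (Subtype.val : A → C) (by simpa using hA)
    (by simpa using hβ) {φ | Contains q φ}
    (fun φ => (Classical.em (Contains q φ)).imp id (contains_not q φ).2)
    (fun φ hφ ψ hψ => (contains_inf q φ ψ).2 ⟨hφ, hψ⟩)
    (fun φ hφ => exists_realize_of_contains hφ)
  refine ⟨c, typeSpace_ext fun φ => ?_⟩
  rw [contains_tpOver]
  refine ⟨fun h => ?_, hc φ⟩
  by_contra hφ
  exact hc φ.not ((contains_not q φ).2 hφ) h

theorem IsDefinable.isBorelDefinable {κ : Cardinal.{w}} {μ : GlobalMeasure L C ι}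
    (hμ : IsDefinable κ M μ) : IsBorelDefinable κ M μ :=
  ⟨hμ.invariant, fun β hβ φ => (hμ.continuous β hβ φ).measurable⟩

/-- Every definable set is of the form `φ(b; C)` for a tuple `b` of any given infinite length. -/
theorem exists_fiber_eq [Infinite β] (X : L.DefinableSet (Set.univ : Set C) ι) :
    ∃ (φ : L.Formula (β ⊕ ι)) (b : β → C), fiber φ b = X := by
  classical
  obtain ⟨ψ, rfl⟩ := exists_solutionSet_eq X
  -- Only the finitely many parameters occurring in `ψ` need a place in the tuple; the other entries
  -- are arbitrary.
  obtain ⟨g⟩ : Nonempty (ψ.freeVarFinset.toLeft ↪ β) :=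
    ⟨(Function.Embedding.refl _).trans
      ((Fintype.equivFin _).toEmbedding.trans (Fin.valEmbedding.trans (Infinite.natEmbedding β)))⟩
  let f : ψ.freeVarFinset → β ⊕ ι := fun z => match z with
    | ⟨Sum.inl c, h⟩ => Sum.inl (g ⟨c, Finset.mem_toLeft.2 h⟩)
    | ⟨Sum.inr i, _⟩ => Sum.inr i
  refine ⟨ψ.restrictFreeVar f,
    Function.extend g (fun c => c.1.1) fun _ => Classical.arbitrary C,
    SetLike.ext fun a => ?_⟩
  rw [mem_fiber, mem_solutionSet]
  refine BoundedFormula.realize_restrictFreeVar _ ?_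
  rintro ⟨c | i, h⟩
  · change Function.extend g (fun c => c.1.1) (fun _ => Classical.arbitrary C) (g ⟨c, _⟩) = c.1
    rw [g.injective.extend_apply]
  · rfl

end FiberMap

/-! ### The pushforward `(h_b)_*(ν)` and existence of the convolution. -/

section Push

variable {L : FirstOrder.Language.{u, v}} {C : Type w} [L.Structure C] [Nonempty C]
  {M : L.ElementarySubstructure C} {ι : Type w} {β γ : Type w}

/-- The measure `(h_b)_*(ν)`, for tuples `b` of arbitrary small length. -/
noncomputable def conjugatePush (m : ι ≃ M) (b : β → C) (ν : GlobalMeasure L C ι) :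
    Measure (TypeSpace L C (M : Set C) β) :=
  ((borelMeasure ν).comap (Subtype.val : typesExtending L (tuple m) → _)).map (conjugateType m b)

variable {κ : Cardinal.{w}} (hC : IsSaturated L C κ) (hκ : ℵ₀ ≤ κ) (hι : #ι < κ)
  (hβ : #β < κ) (m : ι ≃ M) (b : β → C)

section
include hC hκ hι hβ

theorem isProbabilityMeasure_conjugatePush {ν : GlobalMeasure L C ι}
    (hν : ConcentratesOn (tuple m) ν) : IsProbabilityMeasure (conjugatePush m b ν) := by
  have := isProbabilityMeasure_comap hν
  exact Measure.isProbabilityMeasure_map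
    (continuous_conjugateType hC hκ hι hβ m b).measurable.aemeasurable

theorem regular_conjugatePush (ν : GlobalMeasure L C ι) : (conjugatePush m b ν).Regular :=
  regular_map_comap_subtype _ (isClosed_typesExtending _)
    (continuous_conjugateType hC hκ hι hβ m b)

/-- The preimage of `φ` under `h_b` is the trace of `φ*(b; y)` on `S_m(C)`, and restricting to
`S_m(C)` loses nothing because `ν` concentrates there. -/
theorem conjugatePush_contains {ν : GlobalMeasure L C ι} (hν : ConcentratesOn (tuple m) ν)
    (φ : L.Formula ((M : Set C) ⊕ β)) : conjugatePush m b ν {q | Contains q φ} =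
      ENNReal.ofReal (ν (fiber (dual m φ) b)) := by
  have hpre : conjugateType m b ⁻¹' {q | Contains q φ} =
      Subtype.val ⁻¹' {p | Contains p (plug (dual m φ) b)} :=
    Set.ext fun p => contains_conjugateType hC hκ hι hβ m b p φ
  rw [conjugatePush, Measure.map_apply (continuous_conjugateType hC hκ hι hβ m b).measurable
    (isClopen_contains φ).isOpen.measurableSet, hpre,
    (measurableEmbedding_typesExtending _).comap_preimage, Subtype.range_coe,
    ← solutionSet_plug, ← borelMeasure_contains]
  refine measure_inter_conull ?_
  rw [prob_compl_eq_zero_iff (isClosed_typesExtending _).measurableSet]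
  exact hν

/-- Both measures are regular, and on formulas they are given by values of `ν` at instances over `b`
and `b'`, which agree by invariance. This is the source of invariance of `μ ∗ ν`. -/
theorem conjugatePush_eq_of_sameType {ν : GlobalMeasure L C ι} (hν : ConcentratesOn (tuple m) ν)
    (hinv : IsInvariantOver κ M ν) {b' : β → C} (h : SameType L (M : Set C) b b') :
    conjugatePush m b ν = conjugatePush m b' ν := by
  have := regular_conjugatePush hC hκ hι hβ m b ν
  have := regular_conjugatePush hC hκ hι hβ m b' ν
  refine regular_measure_ext_contains fun φ => ?_
  rw [conjugatePush_contains hC hκ hι hβ m b hν, conjugatePush_contains hC hκ hι hβ m b' hν,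
    hinv β hβ _ b b' h]

theorem morleyProduct_conjugatePush {μ : GlobalMeasure L C ι} (hμ : IsBorelDefinable κ M μ)
    (ν : GlobalMeasure L C ι) (φ : L.Formula (β ⊕ ι)) :
    morleyProduct M μ (conjugatePush m b ν) φ =
      ∫ p, fiberMap M μ φ (conjugateType m b p)
        ∂((borelMeasure ν).comap (Subtype.val : typesExtending L (tuple m) → _)) :=
  integral_map (continuous_conjugateType hC hκ hι hβ m b).measurable.aemeasurable
    (hμ.measurable β hβ φ).aestronglyMeasurable

end

theorem integrable_fiberMap {μ : GlobalMeasure L C ι} (hμ : IsBorelDefinable κ M μ) (hβ : #β < κ)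
    (η : Measure (TypeSpace L C (M : Set C) β)) [IsFiniteMeasure η] (φ : L.Formula (β ⊕ ι)) :
    Integrable (fiberMap M μ φ) η :=
  Integrable.of_bound (hμ.measurable β hβ φ).aestronglyMeasurable 1
    (.of_forall fun q => by
      rw [Real.norm_of_nonneg (fiberMap_nonneg μ φ q)]
      exact fiberMap_le_one μ φ q)

section
include hC hκ hι

/-- The integrand in the definition of the convolution product depends only on the definable set
`φ(b; C)`. -/
theorem fiberMap_conjugateType_eq {μ : GlobalMeasure L C ι} (hμ : IsInvariantOver κ M μ)
    (hβ : #β < κ) (hγ : #γ < κ) {φ : L.Formula (β ⊕ ι)} {ψ : L.Formula (γ ⊕ ι)} {b : β → C}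
    {c : γ → C} (h : fiber φ b = fiber ψ c) (p : typesExtending L (tuple m)) :
    fiberMap M μ φ (conjugateType m b p) = fiberMap M μ ψ (conjugateType m c p) := by
  obtain ⟨b', hb, hb'⟩ := exists_isConjugate_and_conjugateType_eq hC hκ hι hβ m b p
  obtain ⟨c', hc, hc'⟩ := exists_isConjugate_and_conjugateType_eq hC hκ hι hγ m c p
  -- Conjugate `b` and `c` simultaneously: by invariance the two halves of `d` may replace `b'` and
  -- `c'`, and equality of fibers passes from the pair to `d`.
  obtain ⟨d, hd⟩ := exists_isConjugate p.2 hC hκ hι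
    (by rw [mk_sum]; simpa using add_lt_of_lt hκ hβ hγ) (Sum.elim b c)
  rw [hb', hc', fiberMap_tpOver hμ hβ, fiberMap_tpOver hμ hγ]
  have h1 := hμ β hβ φ _ _ (hb.sameType (hd.comp Sum.inl))
  have h2 := hμ γ hγ ψ _ _ (hc.sameType (hd.comp Sum.inr))
  rw [h1, h2]
  have hφ : ∀ e : β ⊕ γ → C, fiber (φ.relabel (Sum.map Sum.inl id)) e = fiber φ (e ∘ Sum.inl) :=
    fun e => SetLike.ext fun a => by
      rw [mem_fiber, mem_fiber, Formula.realize_relabel, Sum.elim_comp_map, Function.comp_id]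
  have hψ : ∀ e : β ⊕ γ → C, fiber (ψ.relabel (Sum.map Sum.inr id)) e = fiber ψ (e ∘ Sum.inr) :=
    fun e => SetLike.ext fun a => by
      rw [mem_fiber, mem_fiber, Formula.realize_relabel, Sum.elim_comp_map, Function.comp_id]
  rw [← hφ, ← hψ]
  refine congrArg _ (hd.fiber_eq p.2 ?_)
  rw [hφ, hψ]
  exact h

theorem morleyProduct_conjugatePush_eq {μ ν : GlobalMeasure L C ι} (hμ : IsBorelDefinable κ M μ)
    (hβ : #β < κ) (hγ : #γ < κ) {φ : L.Formula (β ⊕ ι)} {ψ : L.Formula (γ ⊕ ι)} {b : β → C}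
    {c : γ → C} (h : fiber φ b = fiber ψ c) :
    morleyProduct M μ (conjugatePush m b ν) φ = morleyProduct M μ (conjugatePush m c ν) ψ := by
  rw [morleyProduct_conjugatePush hC hκ hι hβ m b hμ,
    morleyProduct_conjugatePush hC hκ hι hγ m c hμ]
  exact integral_congr_ae (.of_forall fun p =>
    fiberMap_conjugateType_eq hC hκ hι m hμ.invariant hβ hγ h p)

/-- The integrands add pointwise: disjointness of the fibers over `b` persists over each conjugate
of `b`, where `μ` is additive. -/
theorem morleyProduct_conjugatePush_add {μ ν : GlobalMeasure L C ι} (hμ : IsBorelDefinable κ M μ)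
    (hν : ConcentratesOn (tuple m) ν) (hβ : #β < κ) {φ ψ : L.Formula (β ⊕ ι)} {b : β → C}
    (h : Disjoint (fiber φ b) (fiber ψ b)) :
    morleyProduct M μ (conjugatePush m b ν) (φ ⊔ ψ) =
      morleyProduct M μ (conjugatePush m b ν) φ + morleyProduct M μ (conjugatePush m b ν) ψ := by
  have := isProbabilityMeasure_comap hν
  have hint : ∀ θ : L.Formula (β ⊕ ι), Integrable
      (fun p => fiberMap M μ θ (conjugateType m b p))
      ((borelMeasure ν).comap (Subtype.val : typesExtending L (tuple m) → _)) := fun θ =>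
    Integrable.of_bound ((hμ.measurable β hβ θ).comp
      (continuous_conjugateType hC hκ hι hβ m b).measurable).aestronglyMeasurable 1
      (.of_forall fun q => by
        rw [Real.norm_of_nonneg (fiberMap_nonneg μ θ _)]
        exact fiberMap_le_one μ θ _)
  simp only [morleyProduct_conjugatePush hC hκ hι hβ m b hμ]
  rw [← integral_add (hint φ) (hint ψ)]
  refine integral_congr_ae (.of_forall fun p => ?_)
  obtain ⟨c, hc, hc'⟩ := exists_isConjugate_and_conjugateType_eq hC hκ hι hβ m b p
  simp only [hc', fiberMap_tpOver hμ.invariant hβ]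
  rw [← μ.additive]
  · refine congrArg _ (SetLike.ext fun a => ?_)
    rw [DefinableSet.mem_sup, mem_fiber, mem_fiber, mem_fiber, Formula.realize_sup]
  · have h0 : fiber (φ ⊓ ψ) b = fiber ⊥ b := SetLike.ext fun a => by
      have := definableSet_disjoint_iff.1 h a
      rw [mem_fiber, mem_fiber] at this
      rw [mem_fiber, mem_fiber, Formula.realize_inf, Formula.realize_bot]
      tauto
    have h1 := hc.fiber_eq p.2 h0
    refine definableSet_disjoint_iff.2 fun a ha ha' => ?_
    have := SetLike.ext_iff.1 h1 a
    rw [mem_fiber, mem_fiber, Formula.realize_inf, Formula.realize_bot] at this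
    exact this.1 ⟨(mem_fiber _ _ _).1 ha, (mem_fiber _ _ _).1 ha'⟩

/-- The convolution product of a Borel-definable measure with a measure concentrated on `tp(m/∅)`
exists. -/
theorem exists_convolution [Infinite ι] {μ ν : GlobalMeasure L C ι} (hμ : IsBorelDefinable κ M μ)
    (hν : ConcentratesOn (tuple m) ν) : ∃ ρ : GlobalMeasure L C ι,
      ∀ (β : Type w), #β < κ → ∀ (φ : L.Formula (β ⊕ ι)) (b : β → C),
        ρ (fiber φ b) = morleyProduct M μ (conjugatePush m b ν) φ := by
  have hιι : #(ι ⊕ ι) < κ := by rw [mk_sum]; simpa using add_lt_of_lt hκ hι hι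
  -- The measure of `X` is computed from an arbitrary presentation `X = φ(b; C)`; by `hval` every
  -- other presentation, of any small length, gives the same value.
  choose Φ B hΦ using exists_fiber_eq (L := L) (C := C) (ι := ι) (β := ι)
  have hval : ∀ (β : Type w), #β < κ → ∀ (φ : L.Formula (β ⊕ ι)) (b : β → C) X, fiber φ b = X →
      morleyProduct M μ (conjugatePush m (B X) ν) (Φ X) =
        morleyProduct M μ (conjugatePush m b ν) φ := fun β hβ φ b X h =>
    morleyProduct_conjugatePush_eq hC hκ hι m hμ hι hβ ((hΦ X).trans h.symm)
  refine ⟨⟨fun X => morleyProduct M μ (conjugatePush m (B X) ν) (Φ X),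
    fun X => integral_nonneg fun q => fiberMap_nonneg μ _ q, ?_, fun X Y h => ?_⟩,
    fun β hβ φ b => hval β hβ φ b _ rfl⟩
  · have htop : ∀ b : ι → C, fiber (⊤ : L.Formula (ι ⊕ ι)) b = ⊤ := fun b =>
      SetLike.ext fun a => by simp [mem_fiber]
    have hP := isProbabilityMeasure_conjugatePush hC hκ hι hι m (B ⊤) hν
    rw [hval ι hι ⊤ (B ⊤) ⊤ (htop _), morleyProduct]
    simp only [fiberMap, htop, μ.top_eq_one]
    simp
  -- For additivity, present both sets over one common parameter tuple.
  · let b : ι ⊕ ι → C := Sum.elim (B X) (B Y)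
    have hX : fiber ((Φ X).relabel (Sum.map Sum.inl id)) b = X := by
      conv_rhs => rw [← hΦ X]
      exact SetLike.ext fun a => by
        rw [mem_fiber, mem_fiber, Formula.realize_relabel, Sum.elim_comp_map, Function.comp_id,
          Sum.elim_comp_inl]
    have hY : fiber ((Φ Y).relabel (Sum.map Sum.inr id)) b = Y := by
      conv_rhs => rw [← hΦ Y]
      exact SetLike.ext fun a => by
        rw [mem_fiber, mem_fiber, Formula.realize_relabel, Sum.elim_comp_map, Function.comp_id,
          Sum.elim_comp_inr]
    rw [hval _ hιι _ b X hX, hval _ hιι _ b Y hY,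
      ← morleyProduct_conjugatePush_add hC hκ hι m hμ hν hιι (by rwa [hX, hY])]
    refine hval _ hιι _ b _ (SetLike.ext fun a => ?_)
    conv_rhs => rw [← hX, ← hY]
    rw [DefinableSet.mem_sup, mem_fiber, mem_fiber, mem_fiber, Formula.realize_sup]

end

end Push

/-! ### Uniform approximation for definable measures. -/

section Approximation

theorem abs_integral_sub_integral_le {X : Type*} [MeasurableSpace X] {η : Measure X}
    [IsProbabilityMeasure η] {F G : X → ℝ} (hF : Integrable F η) (hG : Integrable G η) {ε : ℝ}
    (h : ∀ x, |F x - G x| ≤ ε) : |∫ x, F x ∂η - ∫ x, G x ∂η| ≤ ε := by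
  rw [← integral_sub hF hG]
  have := norm_integral_le_of_norm_le_const (μ := η) (f := fun x => F x - G x) (.of_forall h)
  simpa using this

variable {L : FirstOrder.Language.{u, v}} {C : Type w} [L.Structure C] [Nonempty C]
  {M : L.ElementarySubstructure C} {ι : Type w} {β : Type w}
  {κ : Cardinal.{w}} (hC : IsSaturated L C κ) (hκ : ℵ₀ ≤ κ) (hι : #ι < κ)
  (hβ : #β < κ) (m : ι ≃ M)
include hC hκ hι hβ

/-- If `μ` is definable over `M`, then the values of convolution products `μ ∗ ν` on instances of
`φ` are approximated by averages of values of `ν`, uniformly in `ν` and the parameters. -/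
theorem exists_morleyProduct_near {μ : GlobalMeasure L C ι} (hμ : IsDefinable κ M μ)
    (φ : L.Formula (β ⊕ ι)) {n : ℕ} (hn : 0 < n) :
    ∃ θ : Fin n → L.Formula (β ⊕ ι), ∀ ν : GlobalMeasure L C ι, ConcentratesOn (tuple m) ν →
      ∀ b : β → C, |morleyProduct M μ (conjugatePush m b ν) φ -
        ∑ k, (n : ℝ)⁻¹ * ν (fiber (θ k) b)| ≤ (n : ℝ)⁻¹ := by
  obtain ⟨U, hU⟩ := exists_clopens_average_near (hμ.continuous β hβ φ) (fiberMap_nonneg μ φ)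
    (fiberMap_le_one μ φ) hn
  choose θ hθ using fun k => exists_clopenOf_eq (U k)
  -- The clopen sets were chosen from `μ` and `φ` alone, which is what makes the witnesses
  -- independent of `ν` and `b`.
  refine ⟨fun k => dual m (θ k), fun ν hν b => ?_⟩
  have := isProbabilityMeasure_conjugatePush hC hκ hι hβ m b hν
  have hmeas : ∀ k, MeasurableSet (U k : Set (TypeSpace L C (M : Set C) β)) := fun k =>
    (U k).isClopen.isOpen.measurableSet
  have hint : ∀ k, Integrable (fun q => (n : ℝ)⁻¹ *
      (U k : Set (TypeSpace L C (M : Set C) β)).indicator (fun _ => (1 : ℝ)) q)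
      (conjugatePush m b ν) := fun k =>
    ((integrable_const (1 : ℝ)).indicator (hmeas k)).const_mul _
  have hval : ∫ q, ∑ k, (n : ℝ)⁻¹ *
      (U k : Set (TypeSpace L C (M : Set C) β)).indicator (fun _ => (1 : ℝ)) q
        ∂(conjugatePush m b ν) = ∑ k, (n : ℝ)⁻¹ * ν (fiber (dual m (θ k)) b) := by
    rw [integral_finsetSum _ fun k _ => hint k]
    refine Finset.sum_congr rfl fun k _ => ?_
    rw [integral_const_mul, integral_indicator_const _ (hmeas k), smul_eq_mul, mul_one, ← hθ k]
    have h1 := conjugatePush_contains hC hκ hι hβ m b hν (θ k)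
    change _ * ((conjugatePush m b ν) {q | Contains q (θ k)}).toReal = _
    rw [h1, ENNReal.toReal_ofReal (ν.nonneg _)]
  rw [← hval]
  exact abs_integral_sub_integral_le (integrable_fiberMap hμ.isBorelDefinable hβ _ φ)
    (integrable_finsetSum _ fun k _ => hint k) hU

end Approximation

theorem mk_index_lt {L : FirstOrder.Language.{u, v}} {C : Type w} [L.Structure C]
    {M : L.ElementarySubstructure C} {κ : Cardinal.{w}} (hM : #M < κ) {ι : Type w} (m : ι ≃ M) :
    #ι < κ := (mk_congr m).trans_lt hM

/-! ### Invariance, Borel-definability and associativity of the product. -/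

section Star

variable {L : FirstOrder.Language.{u, v}} {C : Type w} [L.Structure C] [Infinite C]
  {κ : Cardinal.{w}} (hC : IsMonster L C κ)
  {C' : Type w'} [L.Structure C'] {κ' : Cardinal.{w'}} (hC' : IsMonster L C' κ')
  {j : C ↪ₑ[L] C'} (hj : #(Set.range j) < κ')
  {M : L.ElementarySubstructure C} (hM : #M < κ) {ι : Type w} {m : ι ≃ M}
  {μ ν lam : GlobalMeasure L C ι}

theorem infinite_elementarySubstructure (M : L.ElementarySubstructure C) : Infinite M :=
  (M.elementarilyEquivalent.infinite_iff).2 inferInstance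

include hM in
theorem aleph0_le_of_mk_lt : ℵ₀ ≤ κ :=
  have := infinite_elementarySubstructure M
  (aleph0_le_mk M).trans hM.le

include hC hC' hj hM

theorem hPush_eq_conjugatePush (b : ι → C) (ν : GlobalMeasure L C ι) :
    hPush j m b ν = conjugatePush m b ν := by
  rw [hPush, hMap_eq_conjugateType hC' j hj m hC.saturated (aleph0_le_of_mk_lt hM)
    (mk_index_lt hM m), conjugatePush]

theorem isConvolution_starProduct (hμ : IsBorelDefinable κ M μ)
    (hν : ConcentratesOn (tuple m) ν) : IsConvolution j m μ ν (starProduct j m μ ν) := by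
  have : Infinite ι := m.infinite_iff.2 (infinite_elementarySubstructure M)
  obtain ⟨ρ, hρ⟩ := exists_convolution hC.saturated (aleph0_le_of_mk_lt hM) (mk_index_lt hM m) m
    hμ hν
  refine Classical.epsilon_spec ⟨ρ, fun b φ => ?_⟩
  rw [hPush_eq_conjugatePush hC hC' hj hM]
  exact hρ ι (mk_index_lt hM m) φ b

/-- The value of the convolution product at a definable set given by a tuple of any small length. -/
theorem starProduct_fiber (hμ : IsBorelDefinable κ M μ) (hν : ConcentratesOn (tuple m) ν)
    {β : Type w} (hβ : #β < κ) (φ : L.Formula (β ⊕ ι)) (b : β → C) :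
    starProduct j m μ ν (fiber φ b) = morleyProduct M μ (conjugatePush m b ν) φ := by
  have : Infinite ι := m.infinite_iff.2 (infinite_elementarySubstructure M)
  obtain ⟨ψ, c, h⟩ := exists_fiber_eq (β := ι) (fiber φ b)
  rw [← h, isConvolution_starProduct hC hC' hj hM hμ hν c ψ,
    hPush_eq_conjugatePush hC hC' hj hM]
  exact morleyProduct_conjugatePush_eq hC.saturated (aleph0_le_of_mk_lt hM) (mk_index_lt hM m) m
    hμ (mk_index_lt hM m) hβ h

theorem isInvariantOver_starProduct (hμ : IsBorelDefinable κ M μ) (hν : IsInvariantOver κ M ν)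
    (hνm : ConcentratesOn (tuple m) ν) : IsInvariantOver κ M (starProduct j m μ ν) := by
  intro β hβ φ b b' h
  rw [starProduct_fiber hC hC' hj hM hμ hνm hβ, starProduct_fiber hC hC' hj hM hμ hνm hβ,
    conjugatePush_eq_of_sameType hC.saturated (aleph0_le_of_mk_lt hM) (mk_index_lt hM m) hβ m b
      hνm hν h]

/-- For a formula of `tp(m/∅)` the set it defines does not vary with the parameters, so the
integrand is constantly `1`. -/
theorem concentratesOn_starProduct (hν : IsBorelDefinable κ M ν)
    (hνm : ConcentratesOn (tuple m) ν) (hlam : ConcentratesOn (tuple m) lam) :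
    ConcentratesOn (tuple m) (starProduct j m ν lam) := by
  refine concentratesOn_iff.2 fun φ hφ => ?_
  have hfib : ∀ b : ι → C, fiber (φ.relabel Sum.inr : L.Formula (ι ⊕ ι)) b =
      solutionSet (φ.relabel Sum.inr) := fun b => SetLike.ext fun a => by
    rw [mem_fiber, mem_solutionSet, Formula.realize_relabel, Formula.realize_relabel,
      Sum.elim_comp_inr, Sum.elim_comp_inr]
  have := isProbabilityMeasure_conjugatePush hC.saturated (aleph0_le_of_mk_lt hM)
    (mk_index_lt hM m) (mk_index_lt hM m) m (tuple m) hlam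
  rw [← hfib (tuple m), starProduct_fiber hC hC' hj hM hν hlam (mk_index_lt hM m), morleyProduct]
  simp only [fiberMap, hfib, concentratesOn_iff.1 hνm φ hφ]
  simp

/-- If `μ` is definable, then the maps `F_{μ∗ν}` are approximated by averages of maps `F_ν`; the
same averages approximate the values of `μ ∗ λ` for all `λ`. -/
theorem exists_fiberMap_starProduct_near (hμ : IsDefinable κ M μ) (hν : IsInvariantOver κ M ν)
    (hνm : ConcentratesOn (tuple m) ν) {β : Type w} (hβ : #β < κ) (φ : L.Formula (β ⊕ ι)) {n : ℕ}
    (hn : 0 < n) : ∃ θ : Fin n → L.Formula (β ⊕ ι),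
      (∀ q, |fiberMap M (starProduct j m μ ν) φ q - ∑ k, (n : ℝ)⁻¹ * fiberMap M ν (θ k) q| ≤
        (n : ℝ)⁻¹) ∧
      ∀ lam : GlobalMeasure L C ι, ConcentratesOn (tuple m) lam → ∀ b : β → C,
        |starProduct j m μ lam (fiber φ b) - ∑ k, (n : ℝ)⁻¹ * lam (fiber (θ k) b)| ≤
          (n : ℝ)⁻¹ := by
  have hκ := aleph0_le_of_mk_lt hM
  have hμ' := hμ.isBorelDefinable
  obtain ⟨θ, hθ⟩ := exists_morleyProduct_near hC.saturated hκ (mk_index_lt hM m) hβ m hμ φ hn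
  refine ⟨θ, fun q => ?_, fun lam hlam b => ?_⟩
  · obtain ⟨c, rfl⟩ := exists_tpOver_eq hC.saturated hκ hM hβ q
    simp only [fiberMap_tpOver hν hβ,
      fiberMap_tpOver (isInvariantOver_starProduct hC hC' hj hM hμ' hν hνm) hβ,
      starProduct_fiber hC hC' hj hM hμ' hνm hβ]
    exact hθ ν hνm c
  · rw [starProduct_fiber hC hC' hj hM hμ' hlam hβ]
    exact hθ lam hlam b

/-- Each `F_{μ∗ν}^φ` is a pointwise limit of averages of Borel maps `F_ν^θ`. -/
theorem isBorelDefinable_starProduct (hμ : IsDefinable κ M μ) (hν : IsBorelDefinable κ M ν)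
    (hνm : ConcentratesOn (tuple m) ν) : IsBorelDefinable κ M (starProduct j m μ ν) := by
  refine ⟨isInvariantOver_starProduct hC hC' hj hM hμ.isBorelDefinable hν.invariant hνm,
    fun β hβ φ => ?_⟩
  choose θ hθ _ using fun n : ℕ => exists_fiberMap_starProduct_near (j := j) hC hC' hj hM hμ
    hν.invariant hνm hβ φ n.succ_pos
  refine measurable_of_tendsto_metrizable
    (f := fun n q => ∑ k, ((n + 1 : ℕ) : ℝ)⁻¹ * fiberMap M ν (θ n k) q) (fun n => ?_) ?_
  · exact Finset.measurable_sum _ fun k _ => (hν.measurable β hβ (θ n k)).const_mul _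
  · refine tendsto_pi_nhds.2 fun q => tendsto_iff_dist_tendsto_zero.2 ?_
    refine squeeze_zero (fun n => dist_nonneg) (fun n => ?_)
      ((tendsto_inv_atTop_nhds_zero_nat (𝕜 := ℝ)).comp (Filter.tendsto_add_atTop_nat 1))
    rw [dist_comm, Real.dist_eq]
    exact hθ n q

theorem starProduct_assoc (hμ : IsDefinable κ M μ) (hν : IsBorelDefinable κ M ν)
    (hνm : ConcentratesOn (tuple m) ν) (hlamm : ConcentratesOn (tuple m) lam) :
    starProduct j m (starProduct j m μ ν) lam = starProduct j m μ (starProduct j m ν lam) := by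
  have : Infinite ι := m.infinite_iff.2 (infinite_elementarySubstructure M)
  have hι := mk_index_lt hM m
  have hμν := isBorelDefinable_starProduct hC hC' hj hM hμ hν hνm
  have hνlam := concentratesOn_starProduct hC hC' hj hM hν hνm hlamm
  refine KeislerMeasure.ext fun X => ?_
  obtain ⟨φ, b, rfl⟩ := exists_fiber_eq (β := ι) X
  have hP := isProbabilityMeasure_conjugatePush hC.saturated (aleph0_le_of_mk_lt hM) hι hι m b
    hlamm
  have hnear : ∀ n : ℕ, |starProduct j m (starProduct j m μ ν) lam (fiber φ b) -
      starProduct j m μ (starProduct j m ν lam) (fiber φ b)| ≤ 2 * ((n + 1 : ℕ) : ℝ)⁻¹ := by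
    intro n
    obtain ⟨θ, hθ, hθ'⟩ := exists_fiberMap_starProduct_near (j := j) hC hC' hj hM hμ hν.invariant
      hνm hι φ n.succ_pos
    -- The approximation of `μ ∗ λ` is uniform in `λ`, so it may be applied with `ν ∗ λ`, using the
    -- same formulas `θ` as for `F_{μ∗ν}`.
    have hr := hθ' _ hνlam b
    have hint : ∀ k, Integrable (fun q => ((n + 1 : ℕ) : ℝ)⁻¹ * fiberMap M ν (θ k) q)
        (conjugatePush m b lam) := fun k => (integrable_fiberMap hν hι _ (θ k)).const_mul _
    have hl := abs_integral_sub_integral_le (integrable_fiberMap hμν hι (conjugatePush m b lam) φ)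
      (integrable_finsetSum _ fun k _ => hint k) hθ
    rw [integral_finsetSum _ fun k _ => hint k] at hl
    -- Unfolding `(ν ∗ λ)(θ_k(b; y))` as an integral of `F_ν^{θ_k}` makes both estimates compare
    -- with the same average.
    simp only [starProduct_fiber hC hC' hj hM hν hlamm hι] at hr
    rw [starProduct_fiber hC hC' hj hM hμν hlamm hι]
    simp only [integral_const_mul] at hl
    have := abs_sub_le (morleyProduct M (starProduct j m μ ν) (conjugatePush m b lam) φ)
      (∑ k, ((n + 1 : ℕ) : ℝ)⁻¹ * morleyProduct M ν (conjugatePush m b lam) (θ k))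
      (starProduct j m μ (starProduct j m ν lam) (fiber φ b))
    rw [abs_sub_comm] at hr
    exact this.trans ((add_le_add hl hr).trans_eq (two_mul _).symm)
  have hlim : Filter.Tendsto (fun n : ℕ => 2 * ((n + 1 : ℕ) : ℝ)⁻¹) Filter.atTop (nhds (2 * 0)) :=
    ((tendsto_inv_atTop_nhds_zero_nat (𝕜 := ℝ)).comp (Filter.tendsto_add_atTop_nat 1)).const_mul 2
  rw [mul_zero] at hlim
  exact sub_eq_zero.1 (abs_nonpos_iff.1 (ge_of_tendsto' hlim hnear))

end Star

end KeislerConvolution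

open KeislerConvolution
theorem mainTheorem7 {L : FirstOrder.Language.{u, v}}
    -- the monster model `C`, with infinite complete theory
    {C : Type w} [L.Structure C] [Infinite C] (κ : Cardinal.{w}) (hC : IsMonster L C κ)
    -- a larger monster model `C' ≽ C` in which `C` is small
    {C' : Type w'} [L.Structure C'] (κ' : Cardinal.{w'}) (hC' : IsMonster L C' κ')
    (j : C ↪ₑ[L] C') (hj : #(Set.range j) < κ')
    -- a small model `M ≼ C` and an enumeration `m` of it
    (M : L.ElementarySubstructure C) (hM : #M < κ) {ι : Type w} (m : ι ≃ M)
    (μ ν lam : GlobalMeasure L C ι)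
    (hμ : IsDefinable κ M μ)
    (hν : IsBorelDefinable κ M ν) (hνm : ConcentratesOn (tuple m) ν)
    (hlam : IsInvariantOver κ M lam) (hlamm : ConcentratesOn (tuple m) lam) :
    -- the products that occur are defined
    (IsConvolution j m μ ν (starProduct j m μ ν) ∧ IsBorelDefinable κ M (starProduct j m μ ν)) ∧
    (IsConvolution j m ν lam (starProduct j m ν lam) ∧
      IsInvariantOver κ M (starProduct j m ν lam) ∧
      ConcentratesOn (tuple m) (starProduct j m ν lam)) ∧
    IsConvolution j m (starProduct j m μ ν) lam (starProduct j m (starProduct j m μ ν) lam) ∧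
    IsConvolution j m μ (starProduct j m ν lam) (starProduct j m μ (starProduct j m ν lam)) ∧
    -- associativity
    starProduct j m (starProduct j m μ ν) lam = starProduct j m μ (starProduct j m ν lam) := by
  have hμ' := hμ.isBorelDefinable
  have hμν := isBorelDefinable_starProduct hC hC' hj hM hμ hν hνm
  have hνlam := concentratesOn_starProduct hC hC' hj hM hν hνm hlamm
  exact ⟨⟨isConvolution_starProduct hC hC' hj hM hμ' hνm, hμν⟩,
    ⟨isConvolution_starProduct hC hC' hj hM hν hlamm,
      isInvariantOver_starProduct hC hC' hj hM hν hlam hlamm, hνlam⟩,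
    isConvolution_starProduct hC hC' hj hM hμν hlamm,
    isConvolution_starProduct hC hC' hj hM hμ' hνlam,
    starProduct_assoc hC hC' hj hM hμ hν hνm hlamm⟩
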